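/- **Setting.** Let $M$ be a von Neumann algebra acting on a Hilbert space $L$. A *Hilbert space in $M$* is a norm-closed linear subspace $H\subset M$ such that $\psi^*\varphi\in\mathbb C 1$ for all $\psi,\varphi\in H$ (this scalar is the inner product) and such that the vectors $\psi x$ ($\psi\in H$, $x\in L$) span a dense subspace of $L$. For Hilbert spaces $H,H'$ in $M$ put $(H,H')=\{T\in M: TH\subset H'\}$ (the bounded operators from $H$ to $H'$). The tensor product $HH'$ is the closed linear span of the products $\psi\varphi$, and the tensor unit is $\mathbb C=\mathbb C1$. For $T\in(H,H')$ the operator $T\times 1$ is $T$, and $1_H\times T$ is the element $S$ of $M$ with $S\psi=\psi T$ for all $\psi\in H$. The flip $\vartheta_{H,H'}\in(HH',H'H)$ is given by $\vartheta_{H,H'}\psi\varphi=\varphi\psi$. Leg numbering refers to this tensor product and flip. Let $K$ be a Hilbert space in $M$, and let $V$ be a multiplicative unitary on $K^2$, i.e. a unitary $V\in(K^2,K^2)$ with $V_{12}V_{13}V_{23}=V_{23}V_{12}$. The strict tensor category $\mathcal C(V)$ has as objects the corepresentations of $V$: unitaries $W\in(KH,KH)$, with $H$ a Hilbert space in $M$,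 satisfying $V_{12}W_{13}W_{23}=W_{23}V_{12}$ on $K^2H$. Its arrows are $(W,W')=\{T\in(H,H'):(1_K\times T)W=W'(1_K\times T)\}$, and $W\times W'=W_{12}W'_{13}$ on $KHH'$. $V$ itself is the regular corepresentation, on $K$; $\iota(W)$ denotes the trivial corepresentation on $H$, and $\iota(T)=T$. Let $\mathcal C(V)_V$ be the full tensor subcategory of $\mathcal C(V)$ generated by $V$ (its objects are the tensor powers $V^{\times r}$, $r\ge 0$). Let $\mathcal T$ be $\mathcal C(V)$ or $\mathcal C(V)_V$. A *braided symmetry* on $\mathcal T$ (relative to $V$) is a family of unitaries $\varepsilon_W\in(W\times V,V\times W)$, $W\in\mathcal T$, natural in $W$, i.e. $\varepsilon_{W'}\circ(T\times 1_V)=(1_V\times T)\circ\varepsilon_W$ for $T\in(W,W')$, such that $$\varepsilon_{W\times W'}=(\varepsilon_W\times 1_{W'})\circ(1_W\times\varepsilon_{W'})$$ for all $W,W'\in\mathcal T$. For $W\in\mathcal T$ on $H$ put $\xi_W=W^{-1}\in(V\times W,V\times\iota(W))$, $\theta_W=\vartheta_{H,K}$ and $\eta_W=\theta_W^{-1}\xi_W\varepsilon_W$.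 The braided symmetry $\varepsilon$ is *standard* if * $(\xi,V)$ is a left regular object: the $\xi_W\in(V\times W,V\times\iota(W))$ are unitary and natural in $W$, and $\xi_{W\times W'}=(\xi_{W'})_{13}\circ(\xi_W\times 1_{W'})$; * $(V,\eta)$ is a right regular object: the $\eta_W\in(W\times V,\iota(W)\times V)$ are unitary and natural in $W$, and $\eta_{W\times W'}=(\eta_W)_{13}\circ(1_W\times\eta_{W'})$; * $(\eta_W\times 1_{\iota(W')})\circ(1_W\times\xi_{W'})=(1_{\iota(W)}\times\xi_{W'})\circ(\eta_W\times 1_{W'})$ for all $W,W'\in\mathcal T$. Finally let $V^d=\vartheta_{K,K}V^{-1}\vartheta_{K,K}$ be the dual multiplicative unitary, and for $X=V$ and $X=V^d$ let $(X,X)=\{T\in(K,K):(1_K\times T)X=X(1_K\times T)\}$. **Theorem 2.10.** Suppose that the algebra generated by $(V,V)$ and $(V^d,V^d)$ acts irreducibly on $K$, i.e. that $0$ and $K$ are the only closed linear subspaces of $K$ invariant under it. Then any braided symmetry on $\mathcal C(V)_V$ extends uniquely to a braided symmetry on $\mathcal C(V)$. The extension is standard if the original braided symmetry is standard. -/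

import Mathlib

open scoped TensorProduct InnerProductSpace

/-- A Hilbert space in a von Neumann algebra `M` acting on `L`: a norm closed linear subspace of
`M` in which `ψ* φ` is always a scalar multiple of the identity (this scalar is the inner product)
and whose support is the identity, i.e. the vectors `ψ x` span a dense subspace of `L`. -/
structure HilbertIn {L : Type*} [NormedAddCommGroup L] [InnerProductSpace ℂ L] [CompleteSpace L]
    (M : VonNeumannAlgebra L) where
  /-- the underlying linear subspace -/
  carrier : Submodule ℂ (L →L[ℂ] L)
  mem_algebra : ∀ ψ ∈ carrier, ψ ∈ M
  isClosed : IsClosed (carrier : Set (L →L[ℂ] L))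
  inner_scalar : ∀ ψ ∈ carrier, ∀ φ ∈ carrier, ∃ c : ℂ, star ψ * φ = c • (1 : L →L[ℂ] L)
  support : Dense (Submodule.span ℂ {y : L | ∃ ψ ∈ carrier, ∃ x : L, ψ x = y} : Set L)

set_option linter.unusedSectionVars false

namespace HilbertIn

variable {L : Type*} [NormedAddCommGroup L] [InnerProductSpace ℂ L] [CompleteSpace L]
  {M : VonNeumannAlgebra L}

/-- An operator is determined by its left multiplication on a Hilbert space in `M`. -/
theorem op_ext (H : HilbertIn M) {S T : L →L[ℂ] L} (h : ∀ ψ ∈ H.carrier, S * ψ = T * ψ) :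
    S = T := by
  refine ContinuousLinearMap.ext_on H.support ?_
  rintro y ⟨ψ, hψ, x, rfl⟩
  exact congrArg (fun A : L →L[ℂ] L => A x) (h ψ hψ)

/-- `ψ ⊗ x ↦ f ψ x` -/
noncomputable def evalTensor (H : HilbertIn M) (f : H.carrier →ₗ[ℂ] (L →L[ℂ] L)) :
    H.carrier ⊗[ℂ] L →ₗ[ℂ] L :=
  TensorProduct.lift ((ContinuousLinearMap.coeLM ℂ).comp f)

theorem evalTensor_tmul (H : HilbertIn M) (f : H.carrier →ₗ[ℂ] (L →L[ℂ] L))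
    (ψ : H.carrier) (x : L) : H.evalTensor f (ψ ⊗ₜ x) = f ψ x := rfl

/-- `ψ ↦ ψ T` -/
noncomputable def mulRight (H : HilbertIn M) (T : L →L[ℂ] L) :
    H.carrier →ₗ[ℂ] (L →L[ℂ] L) :=
  (LinearMap.mulRight ℂ T).comp H.carrier.subtype

theorem mulRight_apply (H : HilbertIn M) (T : L →L[ℂ] L) (ψ : H.carrier) :
    H.mulRight T ψ = (ψ : L →L[ℂ] L) * T := rfl

theorem inner_evalTensor (H : HilbertIn M) (f : H.carrier →ₗ[ℂ] (L →L[ℂ] L)) (T : L →L[ℂ] L)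
    (hf : ∀ ψ φ : H.carrier, star (f ψ) * f φ = star T * (star (ψ : L →L[ℂ] L) * φ) * T)
    (s t : H.carrier ⊗[ℂ] L) :
    ⟪H.evalTensor f s, H.evalTensor f t⟫_ℂ =
      ⟪H.evalTensor (H.mulRight 1) s, H.evalTensor (H.mulRight (star T * T)) t⟫_ℂ := by
  induction s with
  | zero => simp
  | add s s' hs hs' => simp only [map_add, inner_add_left, hs, hs']
  | tmul ψ x =>
    induction t with
    | zero => simp
    | add t t' ht ht' => simp only [map_add, inner_add_right, ht, ht']
    | tmul φ y =>
      obtain ⟨c, hc⟩ := H.inner_scalar ψ ψ.2 φ φ.2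
      have key : ∀ (A B : L →L[ℂ] L), ⟪A x, B y⟫_ℂ = ⟪x, (star A * B) y⟫_ℂ := by
        intro A B
        rw [mul_apply_eq_comp, ContinuousLinearMap.star_eq_adjoint,
          ContinuousLinearMap.adjoint_inner_right]
      simp only [evalTensor_tmul, mulRight_apply, mul_one]
      rw [key, key, hf, hc, ← mul_assoc, hc]
      simp

theorem denseRange_evalTensor (H : HilbertIn M) : DenseRange (H.evalTensor (H.mulRight 1)) := by
  have h : (Submodule.span ℂ {y : L | ∃ ψ ∈ H.carrier, ∃ x : L, ψ x = y} : Set L) ⊆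
      Set.range (H.evalTensor (H.mulRight 1)) := by
    rw [← LinearMap.coe_range, SetLike.coe_subset_coe, Submodule.span_le]
    rintro y ⟨ψ, hψ, x, rfl⟩
    exact ⟨(⟨ψ, hψ⟩ : H.carrier) ⊗ₜ x, by simp [evalTensor_tmul, mulRight_apply]⟩
  exact H.support.mono h

theorem norm_evalTensor_le (H : HilbertIn M) (f : H.carrier →ₗ[ℂ] (L →L[ℂ] L)) (T : L →L[ℂ] L)
    (hf : ∀ ψ φ : H.carrier, star (f ψ) * f φ = star T * (star (ψ : L →L[ℂ] L) * φ) * T)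
    (t : H.carrier ⊗[ℂ] L) :
    ‖H.evalTensor f t‖ ≤ ‖T‖ * ‖H.evalTensor (H.mulRight 1) t‖ := by
  have hpos : 0 ≤ algebraMap ℝ (L →L[ℂ] L) (‖T‖ ^ 2) - star T * T := by
    rw [sub_nonneg]
    have h := IsSelfAdjoint.le_algebraMap_norm_self (a := star T * T) (IsSelfAdjoint.star_mul_self T)
    rwa [CStarRing.norm_star_mul_self, ← pow_two] at h
  obtain ⟨R, hR⟩ := CStarAlgebra.nonneg_iff_eq_star_mul_self.mp hpos
  have h3 : ∀ t : H.carrier ⊗[ℂ] L, H.evalTensor (H.mulRight (star R * R)) t =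
      ((‖T‖ ^ 2 : ℝ) : ℂ) • H.evalTensor (H.mulRight 1) t
        - H.evalTensor (H.mulRight (star T * T)) t := by
    intro t
    rw [← hR]
    induction t with
    | zero => simp
    | add s t hs ht => rw [map_add, hs, ht, map_add, map_add, smul_add]; abel
    | tmul ψ x =>
      simp only [evalTensor_tmul, mulRight_apply, Algebra.algebraMap_eq_smul_one, mul_sub,
        mul_one, sub_apply, mul_smul_comm]
      rw [Complex.coe_smul]
      rfl
  have h1 := H.inner_evalTensor f T hf t t
  have h2 := H.inner_evalTensor (H.mulRight R) R
    (fun ψ φ => by simp only [mulRight_apply, star_mul, mul_assoc]) t t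
  rw [h3, inner_sub_right, ← h1, inner_smul_right] at h2
  rw [inner_self_eq_norm_sq_to_K, inner_self_eq_norm_sq_to_K, inner_self_eq_norm_sq_to_K] at h2
  have h5 := congrArg Complex.re h2
  simp only [Complex.coe_algebraMap, ← Complex.ofReal_pow, ← Complex.ofReal_mul, Complex.sub_re,
    Complex.ofReal_re] at h5
  refine le_of_sq_le_sq ?_ (by positivity)
  rw [mul_pow]
  have h6 := sq_nonneg ‖H.evalTensor (H.mulRight R) t‖
  linarith

/-- A family `ψ ↦ f ψ` with `(f ψ)* (f φ) = T* ψ* φ T` is `ψ ↦ S ψ` for some operator `S`. -/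
theorem exists_mul_eq (H : HilbertIn M) (f : H.carrier →ₗ[ℂ] (L →L[ℂ] L)) (T : L →L[ℂ] L)
    (hf : ∀ ψ φ : H.carrier, star (f ψ) * f φ = star T * (star (ψ : L →L[ℂ] L) * φ) * T) :
    ∃ S : L →L[ℂ] L, ∀ ψ : H.carrier, S * ψ = f ψ := by
  let _ : AddCommGroup (H.carrier ⊗[ℂ] L) := TensorProduct.addCommGroup
  refine ⟨(H.evalTensor f).extendOfNorm (H.evalTensor (H.mulRight 1)), fun ψ => ?_⟩
  ext x
  have h := LinearMap.extendOfNorm_eq (f := H.evalTensor f) H.denseRange_evalTensor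
    ⟨‖T‖, H.norm_evalTensor_le f T hf⟩ (ψ ⊗ₜ x)
  simpa [evalTensor_tmul, mulRight_apply] using h

/-- An operator which sends a Hilbert space in `M` into `M` lies in `M`. -/
theorem mem_of_mul_mem (H : HilbertIn M) {S : L →L[ℂ] L} (h : ∀ ψ ∈ H.carrier, S * ψ ∈ M) :
    S ∈ M := by
  rw [← VonNeumannAlgebra.commutant_commutant M, VonNeumannAlgebra.mem_commutant_iff]
  intro g hg
  rw [VonNeumannAlgebra.mem_commutant_iff] at hg
  refine H.op_ext fun ψ hψ => ?_
  rw [mul_assoc, ← hg _ (h ψ hψ), mul_assoc, mul_assoc, hg _ (H.mem_algebra ψ hψ)]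

theorem exists_amp (H : HilbertIn M) (T : L →L[ℂ] L) :
    ∃ S : L →L[ℂ] L, ∀ ψ ∈ H.carrier, S * ψ = ψ * T := by
  obtain ⟨S, hS⟩ := H.exists_mul_eq (H.mulRight T) T
    (fun ψ φ => by simp only [mulRight_apply, star_mul, mul_assoc])
  exact ⟨S, fun ψ hψ => hS ⟨ψ, hψ⟩⟩

/-- `1_H × T`: the unique operator `S` with `S ψ = ψ T` for all `ψ ∈ H`, that is
`∑ ψᵢ T ψᵢ*` for an orthonormal basis `ψᵢ` of `H`. (Tensoring on the right by `1_H` does not change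
the operator.) -/
noncomputable def amp (H : HilbertIn M) (T : L →L[ℂ] L) : L →L[ℂ] L :=
  Classical.choose (H.exists_amp T)

theorem amp_mul (H : HilbertIn M) (T : L →L[ℂ] L) {ψ : L →L[ℂ] L} (hψ : ψ ∈ H.carrier) :
    H.amp T * ψ = ψ * T :=
  Classical.choose_spec (H.exists_amp T) ψ hψ

theorem amp_mul_assoc (H : HilbertIn M) (T : L →L[ℂ] L) {ψ : L →L[ℂ] L} (hψ : ψ ∈ H.carrier)
    (R : L →L[ℂ] L) : H.amp T * (ψ * R) = ψ * (T * R) := by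
  rw [← mul_assoc, H.amp_mul T hψ, mul_assoc]

theorem amp_one (H : HilbertIn M) : H.amp 1 = 1 :=
  H.op_ext fun ψ hψ => by rw [H.amp_mul _ hψ, mul_one, one_mul]

theorem amp_comp (H : HilbertIn M) (S T : L →L[ℂ] L) : H.amp (S * T) = H.amp S * H.amp T :=
  H.op_ext fun ψ hψ => by
    rw [H.amp_mul _ hψ, mul_assoc, H.amp_mul _ hψ, H.amp_mul_assoc _ hψ]

theorem star_mul_ext (H : HilbertIn M) {S T : L →L[ℂ] L}
    (h : ∀ ψ ∈ H.carrier, star ψ * S = star ψ * T) : S = T := by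
  apply star_injective
  refine H.op_ext fun ψ hψ => ?_
  simpa using congrArg star (h ψ hψ)

theorem star_mul_amp (H : HilbertIn M) (T : L →L[ℂ] L) {ψ : L →L[ℂ] L} (hψ : ψ ∈ H.carrier) :
    star ψ * H.amp T = T * star ψ := by
  refine H.op_ext fun φ hφ => ?_
  obtain ⟨c, hc⟩ := H.inner_scalar ψ hψ φ hφ
  rw [mul_assoc, H.amp_mul _ hφ, ← mul_assoc, hc, mul_assoc, hc]
  simp

theorem amp_star (H : HilbertIn M) (T : L →L[ℂ] L) : H.amp (star T) = star (H.amp T) :=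
  H.star_mul_ext fun ψ hψ => by
    rw [H.star_mul_amp _ hψ, ← star_mul, ← H.amp_mul _ hψ, star_mul]

theorem amp_mem (H : HilbertIn M) {T : L →L[ℂ] L} (hT : T ∈ M) : H.amp T ∈ M :=
  H.mem_of_mul_mem fun ψ hψ => by
    rw [H.amp_mul _ hψ]; exact mul_mem (H.mem_algebra ψ hψ) hT

theorem amp_unitary (H : HilbertIn M) {T : L →L[ℂ] L} (hT : T ∈ unitary (L →L[ℂ] L)) :
    H.amp T ∈ unitary (L →L[ℂ] L) := by
  rw [Unitary.mem_iff] at hT ⊢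
  rw [← amp_star, ← amp_comp, ← amp_comp, hT.1, hT.2, amp_one]
  exact ⟨rfl, rfl⟩

theorem exists_flip (H H' : HilbertIn M) :
    ∃ S : L →L[ℂ] L, ∀ ψ ∈ H.carrier, S * ψ = H'.amp ψ := by
  let f : H.carrier →ₗ[ℂ] (L →L[ℂ] L) :=
    { toFun := fun ψ => H'.amp ψ
      map_add' := fun ψ φ => H'.op_ext fun χ hχ => by
        rw [H'.amp_mul _ hχ, add_mul, H'.amp_mul _ hχ, H'.amp_mul _ hχ, Submodule.coe_add, mul_add]
      map_smul' := fun c ψ => H'.op_ext fun χ hχ => by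
        simp [H'.amp_mul _ hχ] }
  obtain ⟨S, hS⟩ := H.exists_mul_eq f 1 (fun ψ φ => by
    obtain ⟨c, hc⟩ := H.inner_scalar ψ ψ.2 φ φ.2
    change star (H'.amp ψ) * H'.amp φ = _
    rw [← amp_star, ← amp_comp, hc]
    refine H'.op_ext fun χ hχ => ?_
    rw [H'.amp_mul _ hχ]
    simp)
  exact ⟨S, fun ψ hψ => hS ⟨ψ, hψ⟩⟩

/-- The flip `ϑ_{H,H'}`, an operator from `H H'` to `H' H`: the unique operator `S` with
`S ψ φ = φ ψ` for all `ψ ∈ H` and `φ ∈ H'`. -/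
noncomputable def flip (H H' : HilbertIn M) : L →L[ℂ] L :=
  Classical.choose (exists_flip H H')

theorem flip_mul (H H' : HilbertIn M) {ψ : L →L[ℂ] L} (hψ : ψ ∈ H.carrier) :
    flip H H' * ψ = H'.amp ψ :=
  Classical.choose_spec (exists_flip H H') ψ hψ

theorem flip_mul_mul (H H' : HilbertIn M) {ψ φ : L →L[ℂ] L} (hψ : ψ ∈ H.carrier)
    (hφ : φ ∈ H'.carrier) : flip H H' * (ψ * φ) = φ * ψ := by
  rw [← mul_assoc, flip_mul H H' hψ, H'.amp_mul _ hφ]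

theorem flip_mul_mul_assoc (H H' : HilbertIn M) {ψ φ : L →L[ℂ] L} (hψ : ψ ∈ H.carrier)
    (hφ : φ ∈ H'.carrier) (R : L →L[ℂ] L) : flip H H' * (ψ * (φ * R)) = φ * (ψ * R) := by
  rw [← mul_assoc, flip_mul H H' hψ, H'.amp_mul_assoc _ hφ]

theorem op_ext₂ (H H' : HilbertIn M) {S T : L →L[ℂ] L}
    (h : ∀ ψ ∈ H.carrier, ∀ φ ∈ H'.carrier, S * (ψ * φ) = T * (ψ * φ)) : S = T :=
  H.op_ext fun ψ hψ => H'.op_ext fun φ hφ => by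
    rw [mul_assoc, mul_assoc]; exact h ψ hψ φ hφ

theorem flip_flip (H H' : HilbertIn M) : flip H' H * flip H H' = 1 :=
  op_ext₂ H H' fun ψ hψ φ hφ => by
    rw [mul_assoc, flip_mul_mul H H' hψ hφ, flip_mul_mul H' H hφ hψ, one_mul]

theorem flip_star (H H' : HilbertIn M) : star (flip H H') = flip H' H := by
  have h : star (flip H H') * flip H H' = 1 := by
    refine H.op_ext fun ψ hψ => H.star_mul_ext fun χ hχ => ?_
    obtain ⟨c, hc⟩ := H.inner_scalar χ hχ ψ hψ
    rw [one_mul, hc, mul_assoc, ← mul_assoc, ← star_mul, flip_mul H H' hψ, flip_mul H H' hχ,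
      ← amp_star, ← amp_comp, hc]
    refine H'.op_ext fun φ hφ => ?_
    rw [H'.amp_mul _ hφ]
    simp
  calc star (flip H H') = star (flip H H') * (flip H H' * flip H' H) := by
        rw [flip_flip, mul_one]
    _ = flip H' H := by rw [← mul_assoc, h, one_mul]

theorem flip_unitary (H H' : HilbertIn M) : flip H H' ∈ unitary (L →L[ℂ] L) := by
  rw [Unitary.mem_iff, flip_star]
  exact ⟨flip_flip H H', flip_flip H' H⟩

theorem flip_mem (H H' : HilbertIn M) : flip H H' ∈ M :=
  H.mem_of_mul_mem fun ψ hψ => by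
    rw [flip_mul H H' hψ]; exact H'.amp_mem (H.mem_algebra ψ hψ)

/-- The tensor unit: the Hilbert space `ℂ 1`. -/
def unit (M : VonNeumannAlgebra L) : HilbertIn M where
  carrier := Submodule.span ℂ {1}
  mem_algebra := by
    intro ψ hψ
    obtain ⟨c, rfl⟩ := Submodule.mem_span_singleton.1 hψ
    exact M.toStarSubalgebra.smul_mem (one_mem _) c
  isClosed := Submodule.closed_of_finiteDimensional _
  inner_scalar := by
    intro ψ hψ φ hφ
    obtain ⟨c, rfl⟩ := Submodule.mem_span_singleton.1 hψ
    obtain ⟨d, rfl⟩ := Submodule.mem_span_singleton.1 hφ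
    exact ⟨d * star c, by simp [smul_smul]⟩
  support := by
    have : (Submodule.span ℂ {y : L | ∃ ψ ∈ Submodule.span ℂ {(1 : L →L[ℂ] L)}, ∃ x : L, ψ x = y}
        : Set L) = Set.univ := by
      refine Set.eq_univ_of_forall fun x => Submodule.subset_span ?_
      exact ⟨1, Submodule.mem_span_singleton_self _, x, rfl⟩
    rw [this]
    exact dense_univ

theorem isClosed_scalars : IsClosed {A : L →L[ℂ] L | ∃ c : ℂ, A = c • (1 : L →L[ℂ] L)} := by
  have h : {A : L →L[ℂ] L | ∃ c : ℂ, A = c • (1 : L →L[ℂ] L)} =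
      (Submodule.span ℂ {(1 : L →L[ℂ] L)} : Set (L →L[ℂ] L)) := by
    ext A
    simp [Submodule.mem_span_singleton, eq_comm]
  rw [h]
  exact Submodule.closed_of_finiteDimensional _

/-- Induction principle for the closed linear span of products. -/
theorem mul_closure_induction {E F : Submodule ℂ (L →L[ℂ] L)} {p : (L →L[ℂ] L) → Prop}
    (hmul : ∀ ψ ∈ E, ∀ φ ∈ F, p (ψ * φ)) (hadd : ∀ a b, p a → p b → p (a + b))
    (hcl : IsClosed {a | p a}) {a : L →L[ℂ] L} (ha : a ∈ (E * F).topologicalClosure) : p a := by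
  have h : ((E * F : Submodule ℂ (L →L[ℂ] L)) : Set (L →L[ℂ] L)) ⊆ {a | p a} := fun b hb =>
    Submodule.mul_induction_on hb hmul hadd
  exact closure_minimal h hcl ha

/-- The tensor product `H H'`: the closed linear span of the products `ψ φ`. -/
noncomputable def tensor (H H' : HilbertIn M) : HilbertIn M where
  carrier := (H.carrier * H'.carrier).topologicalClosure
  mem_algebra := by
    intro a ha
    have hcl : IsClosed {a : L →L[ℂ] L | a ∈ M} := by
      have : {a : L →L[ℂ] L | a ∈ M} = Set.centralizer (M.commutant : Set (L →L[ℂ] L)) := by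
        conv_lhs => rw [← VonNeumannAlgebra.commutant_commutant M]
        exact VonNeumannAlgebra.coe_commutant _
      rw [this]
      exact Set.isClosed_centralizer _
    exact mul_closure_induction (p := fun a => a ∈ M)
      (fun ψ hψ φ hφ => mul_mem (H.mem_algebra ψ hψ) (H'.mem_algebra φ hφ))
      (fun a b ha hb => add_mem ha hb) hcl ha
  isClosed := Submodule.isClosed_topologicalClosure _
  inner_scalar := by
    intro a ha b hb
    have hadd : ∀ A B : L →L[ℂ] L, (∃ c : ℂ, A = c • (1 : L →L[ℂ] L)) →
        (∃ c : ℂ, B = c • (1 : L →L[ℂ] L)) → ∃ c : ℂ, A + B = c • (1 : L →L[ℂ] L) := by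
      rintro A B ⟨c, rfl⟩ ⟨d, rfl⟩
      exact ⟨c + d, (add_smul _ _ _).symm⟩
    refine mul_closure_induction (p := fun a => ∃ c : ℂ, star a * b = c • (1 : L →L[ℂ] L))
      (fun ψ hψ φ hφ => ?_) (fun a a' h h' => by rw [star_add, add_mul]; exact hadd _ _ h h')
      (isClosed_scalars.preimage (f := fun a : L →L[ℂ] L => star a * b) (by fun_prop)) ha
    refine mul_closure_induction
      (p := fun b => ∃ c : ℂ, star (ψ * φ) * b = c • (1 : L →L[ℂ] L))
      (fun ψ' hψ' φ' hφ' => ?_) (fun a a' h h' => by rw [mul_add]; exact hadd _ _ h h')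
      (isClosed_scalars.preimage (f := fun b : L →L[ℂ] L => star (ψ * φ) * b) (by fun_prop)) hb
    obtain ⟨c, hc⟩ := H.inner_scalar ψ hψ ψ' hψ'
    obtain ⟨d, hd⟩ := H'.inner_scalar φ hφ φ' hφ'
    refine ⟨c * d, ?_⟩
    rw [star_mul, mul_assoc, ← mul_assoc (star ψ), hc]
    simp [hd, smul_smul]
  support := by
    set D := Submodule.span ℂ {y : L | ∃ ψ ∈ (H.carrier * H'.carrier).topologicalClosure,
      ∃ x : L, ψ x = y} with hD
    have h1 : ∀ ψ ∈ H.carrier, ∀ x : L, ψ x ∈ D.topologicalClosure := by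
      intro ψ hψ x
      have hcl : IsClosed {x : L | ψ x ∈ D.topologicalClosure} :=
        D.isClosed_topologicalClosure.preimage ψ.continuous
      have hsub : (Submodule.span ℂ {y : L | ∃ φ ∈ H'.carrier, ∃ x : L, φ x = y} : Set L) ⊆
          {x : L | ψ x ∈ D.topologicalClosure} := by
        have : Submodule.span ℂ {y : L | ∃ φ ∈ H'.carrier, ∃ x : L, φ x = y} ≤
            D.topologicalClosure.comap (ψ : L →ₗ[ℂ] L) := by
          rw [Submodule.span_le]
          rintro y ⟨φ, hφ, x, rfl⟩
          refine D.le_topologicalClosure (Submodule.subset_span ⟨ψ * φ, ?_, x, rfl⟩)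
          exact Submodule.le_topologicalClosure _ (Submodule.mul_mem_mul hψ hφ)
        exact this
      exact closure_minimal hsub hcl (H'.support x)
    have h2 : Submodule.span ℂ {y : L | ∃ ψ ∈ H.carrier, ∃ x : L, ψ x = y} ≤
        D.topologicalClosure := by
      rw [Submodule.span_le]
      rintro y ⟨ψ, hψ, x, rfl⟩
      exact h1 ψ hψ x
    intro x
    exact closure_minimal (fun y hy => h2 hy) D.isClosed_topologicalClosure (H.support x)

theorem mul_mem_tensor (H H' : HilbertIn M) {ψ φ : L →L[ℂ] L} (hψ : ψ ∈ H.carrier)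
    (hφ : φ ∈ H'.carrier) : ψ * φ ∈ (H.tensor H').carrier :=
  Submodule.le_topologicalClosure _ (Submodule.mul_mem_mul hψ hφ)

theorem tensor_induction (H H' : HilbertIn M) {p : (L →L[ℂ] L) → Prop}
    (hmul : ∀ ψ ∈ H.carrier, ∀ φ ∈ H'.carrier, p (ψ * φ)) (hadd : ∀ a b, p a → p b → p (a + b))
    (hcl : IsClosed {a | p a}) {a : L →L[ℂ] L} (ha : a ∈ (H.tensor H').carrier) : p a :=
  mul_closure_induction hmul hadd hcl ha

/-- The arrows `(H, H')`: the elements `T` of `M` with `T H ⊆ H'`. The element `T` acts as the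
bounded operator `ψ ↦ T ψ` from `H` to `H'`, and composition of arrows is multiplication. -/
def IsArrow (H H' : HilbertIn M) (T : L →L[ℂ] L) : Prop :=
  T ∈ M ∧ ∀ ψ ∈ H.carrier, T * ψ ∈ H'.carrier

/-- For an operator `X` on `A C`, the operator `X₁₃` on `A B C`. -/
noncomputable def leg13 (A B C : HilbertIn M) (X : L →L[ℂ] L) : L →L[ℂ] L :=
  A.amp (flip C B) * X * A.amp (flip B C)

theorem ext_carrier {H H' : HilbertIn M} (h : H.carrier = H'.carrier) : H = H' := by
  cases H; cases H'; congr

theorem tensor_assoc (A B C : HilbertIn M) :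
    (A.tensor B).tensor C = A.tensor (B.tensor C) := by
  apply ext_carrier
  apply le_antisymm
  · intro a ha
    refine tensor_induction (A.tensor B) C (p := fun a => a ∈ (A.tensor (B.tensor C)).carrier)
      (fun d hd χ hχ => ?_) (fun _ _ h h' => add_mem h h') (A.tensor (B.tensor C)).isClosed ha
    refine tensor_induction A B (p := fun d => d * χ ∈ (A.tensor (B.tensor C)).carrier)
      (fun ψ hψ φ hφ => ?_) (fun _ _ h h' => by rw [add_mul]; exact add_mem h h')
      ((A.tensor (B.tensor C)).isClosed.preimage (f := fun d : L →L[ℂ] L => d * χ) (by fun_prop)) hd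
    rw [mul_assoc]
    exact mul_mem_tensor _ _ hψ (mul_mem_tensor _ _ hφ hχ)
  · intro a ha
    refine tensor_induction A (B.tensor C) (p := fun a => a ∈ ((A.tensor B).tensor C).carrier)
      (fun ψ hψ d hd => ?_) (fun _ _ h h' => add_mem h h') ((A.tensor B).tensor C).isClosed ha
    refine tensor_induction B C (p := fun d => ψ * d ∈ ((A.tensor B).tensor C).carrier)
      (fun φ hφ χ hχ => ?_) (fun _ _ h h' => by rw [mul_add]; exact add_mem h h')
      (((A.tensor B).tensor C).isClosed.preimage (f := fun d : L →L[ℂ] L => ψ * d) (by fun_prop)) hd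
    rw [← mul_assoc]
    exact mul_mem_tensor _ _ (mul_mem_tensor _ _ hψ hφ) hχ

namespace IsArrow

theorem comp {H H' H'' : HilbertIn M} {S T : L →L[ℂ] L} (hS : IsArrow H' H'' S)
    (hT : IsArrow H H' T) : IsArrow H H'' (S * T) :=
  ⟨mul_mem hS.1 hT.1, fun ψ hψ => by rw [mul_assoc]; exact hS.2 _ (hT.2 ψ hψ)⟩

theorem tensor_right {H H' : HilbertIn M} {T : L →L[ℂ] L} (hT : IsArrow H H' T)
    (C : HilbertIn M) : IsArrow (H.tensor C) (H'.tensor C) T := by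
  refine ⟨hT.1, fun a ha => ?_⟩
  refine tensor_induction H C (p := fun a => T * a ∈ (H'.tensor C).carrier)
    (fun ψ hψ φ hφ => ?_) (fun _ _ h h' => by rw [mul_add]; exact add_mem h h')
    ((H'.tensor C).isClosed.preimage (f := fun d : L →L[ℂ] L => T * d) (by fun_prop)) ha
  rw [← mul_assoc]
  exact mul_mem_tensor _ _ (hT.2 ψ hψ) hφ

theorem amp {H H' : HilbertIn M} {T : L →L[ℂ] L} (hT : IsArrow H H' T)
    (A : HilbertIn M) : IsArrow (A.tensor H) (A.tensor H') (A.amp T) := by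
  refine ⟨A.amp_mem hT.1, fun a ha => ?_⟩
  refine tensor_induction A H (p := fun a => A.amp T * a ∈ (A.tensor H').carrier)
    (fun ψ hψ φ hφ => ?_) (fun _ _ h h' => by rw [mul_add]; exact add_mem h h')
    ((A.tensor H').isClosed.preimage (f := fun d : L →L[ℂ] L => A.amp T * d) (by fun_prop)) ha
  rw [A.amp_mul_assoc _ hψ]
  exact mul_mem_tensor _ _ hψ (hT.2 φ hφ)

theorem leg13 {A C : HilbertIn M} {X : L →L[ℂ] L} (hX : IsArrow (A.tensor C) (A.tensor C) X)
    (B : HilbertIn M) :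
    IsArrow (A.tensor (B.tensor C)) (A.tensor (B.tensor C)) (HilbertIn.leg13 A B C X) := by
  have hflip : ∀ B C : HilbertIn M, IsArrow (B.tensor C) (C.tensor B) (flip B C) := by
    intro B C
    refine ⟨flip_mem B C, fun a ha => ?_⟩
    refine tensor_induction B C (p := fun a => flip B C * a ∈ (C.tensor B).carrier)
      (fun ψ hψ φ hφ => ?_) (fun _ _ h h' => by rw [mul_add]; exact add_mem h h')
      ((C.tensor B).isClosed.preimage (f := fun d : L →L[ℂ] L => flip B C * d) (by fun_prop)) ha
    rw [flip_mul_mul _ _ hψ hφ]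
    exact mul_mem_tensor _ _ hφ hψ
  have hX' := hX.tensor_right B
  rw [tensor_assoc] at hX'
  exact (((hflip C B).amp A).comp hX').comp ((hflip B C).amp A)

/-- An arrow from `H` to `H'` commutes with operators acting to the right of `H` and `H'`. -/
theorem mul_amp {H H' : HilbertIn M} {T : L →L[ℂ] L} (hT : IsArrow H H' T) (S : L →L[ℂ] L) :
    T * H.amp S = H'.amp S * T :=
  H.op_ext fun ψ hψ => by
    rw [mul_assoc, H.amp_mul _ hψ, mul_assoc, H'.amp_mul _ (hT.2 ψ hψ), mul_assoc]

end IsArrow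

theorem amp_tensor (H H' : HilbertIn M) (T : L →L[ℂ] L) :
    (H.tensor H').amp T = H.amp (H'.amp T) :=
  op_ext₂ H H' fun ψ hψ φ hφ => by
    rw [amp_mul _ _ (mul_mem_tensor _ _ hψ hφ), H.amp_mul_assoc _ hψ, H'.amp_mul _ hφ, mul_assoc]

/-- The flip commutes with operators acting to the right of both factors. -/
theorem flip_mul_amp_amp (H H' : HilbertIn M) (T : L →L[ℂ] L) :
    flip H H' * H.amp (H'.amp T) = H'.amp (H.amp T) * flip H H' :=
  op_ext₂ H H' fun ψ hψ φ hφ => by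
    rw [mul_assoc, H.amp_mul_assoc _ hψ, H'.amp_mul _ hφ, flip_mul_mul_assoc _ _ hψ hφ, mul_assoc,
      flip_mul_mul _ _ hψ hφ, H'.amp_mul_assoc _ hφ, H.amp_mul _ hψ]

/-- The flip exchanges an operator on the first factor with one on the second. -/
theorem flip_mul_left {H : HilbertIn M} (H' : HilbertIn M) {R : L →L[ℂ] L}
    (hR : IsArrow H H R) : flip H H' * R = H'.amp R * flip H H' :=
  op_ext₂ H H' fun ψ hψ φ hφ => by
    rw [mul_assoc, ← mul_assoc R, flip_mul_mul _ _ (hR.2 ψ hψ) hφ, mul_assoc,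
      flip_mul_mul _ _ hψ hφ, H'.amp_mul_assoc _ hφ]

theorem flip_tensor_left (A B C : HilbertIn M) :
    flip (A.tensor B) C = flip A C * A.amp (flip B C) :=
  op_ext₂ A B fun ψ hψ φ hφ => C.op_ext fun χ hχ => by
    rw [mul_assoc, flip_mul_mul _ _ (mul_mem_tensor _ _ hψ hφ) hχ, mul_assoc, mul_assoc,
      mul_assoc, A.amp_mul_assoc _ hψ, flip_mul_mul _ _ hφ hχ, flip_mul_mul_assoc _ _ hψ hχ]

theorem flip_tensor_right (A B C : HilbertIn M) :
    flip C (A.tensor B) = A.amp (flip C B) * flip C A := by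
  rw [← flip_star, flip_tensor_left, star_mul, ← amp_star, flip_star, flip_star]

/-- For `X` on `A C`, conjugating `1_A × X` by the flip of the first two factors of `A A C`
gives `X₁₃`. -/
theorem leg13_eq {A C : HilbertIn M} {X : L →L[ℂ] L}
    (hX : IsArrow (A.tensor C) (A.tensor C) X) :
    leg13 A A C X = flip A A * A.amp X * flip A A := by
  have key : ∀ a ∈ (A.tensor C).carrier, ∀ ψ ∈ A.carrier,
      A.amp (flip C A) * (a * ψ) = flip A A * (ψ * a) := by
    intro a ha ψ hψ
    refine tensor_induction A C
      (p := fun a => A.amp (flip C A) * (a * ψ) = flip A A * (ψ * a))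
      (fun φ hφ χ hχ => ?_) (fun a b h h' => by rw [add_mul, mul_add, h, h', mul_add, mul_add])
      (isClosed_eq (by fun_prop) (by fun_prop)) ha
    rw [mul_assoc, A.amp_mul_assoc _ hφ, flip_mul_mul _ _ hχ hψ, flip_mul_mul_assoc _ _ hψ hφ]
  refine op_ext₂ A A fun ψ hψ φ hφ => C.op_ext fun χ hχ => ?_
  simp only [leg13, mul_assoc]
  rw [A.amp_mul_assoc _ hψ, flip_mul_mul _ _ hφ hχ, flip_mul_mul_assoc _ _ hψ hφ,
    A.amp_mul_assoc _ hφ, ← mul_assoc ψ, ← mul_assoc X,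
    key _ (hX.2 _ (mul_mem_tensor _ _ hψ hχ)) _ hφ]

/-- For `X` on `A C`, the operator `X₁₃` on `A B C` commutes with operators on `B`. -/
theorem leg13_commute {A B C : HilbertIn M} {X R : L →L[ℂ] L}
    (hX : IsArrow (A.tensor C) (A.tensor C) X) (hR : IsArrow B B R) :
    leg13 A B C X * A.amp R = A.amp R * leg13 A B C X := by
  have h1 : A.amp (flip B C) * A.amp R = A.amp (C.amp R) * A.amp (flip B C) := by
    rw [← amp_comp, ← amp_comp, flip_mul_left C hR]
  have h2 : A.amp (flip C B) * A.amp (C.amp R) = A.amp R * A.amp (flip C B) := by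
    rw [← amp_comp, ← amp_comp]
    congr 1
    calc flip C B * C.amp R = flip C B * (C.amp R * flip B C) * flip C B := by
          rw [mul_assoc, mul_assoc, flip_flip, mul_one]
      _ = R * flip C B := by
          rw [← flip_mul_left C hR, ← mul_assoc (flip C B), flip_flip, one_mul]
  have h3 : X * A.amp (C.amp R) = A.amp (C.amp R) * X := by
    rw [← amp_tensor, hX.mul_amp]
  unfold leg13
  rw [mul_assoc, h1, ← mul_assoc, mul_assoc _ X, h3, ← mul_assoc, h2]
  simp only [mul_assoc]

theorem leg13_unitary {A B C : HilbertIn M} {X : L →L[ℂ] L}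
    (hX : X ∈ unitary (L →L[ℂ] L)) : leg13 A B C X ∈ unitary (L →L[ℂ] L) :=
  mul_mem (mul_mem (A.amp_unitary (flip_unitary C B)) hX) (A.amp_unitary (flip_unitary B C))

/-- For `X` on `A C`, the operator `X₁₄` on `A A B C` computed in two ways. -/
theorem leg13_tensor {A B C : HilbertIn M} {X : L →L[ℂ] L}
    (hX : IsArrow (A.tensor C) (A.tensor C) X) :
    flip A A * A.amp (leg13 A B C X) * flip A A = leg13 A (A.tensor B) C X := by
  have h : leg13 A (A.tensor B) C X =
      A.amp (A.amp (flip C B)) * leg13 A A C X * A.amp (A.amp (flip B C)) := by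
    simp only [leg13, flip_tensor_left, flip_tensor_right, amp_comp, mul_assoc]
  rw [h, leg13_eq hX]
  simp only [leg13, amp_comp]
  rw [← mul_assoc, ← mul_assoc, flip_mul_amp_amp]
  simp only [mul_assoc]
  rw [flip_mul_amp_amp]

/-- The algebraic core of the tensor product of corepresentations. -/
theorem corep_tensor {K H H' : HilbertIn M} {V W W' : L →L[ℂ] L}
    (hV : IsArrow (K.tensor K) (K.tensor K) V) (hW : IsArrow (K.tensor H) (K.tensor H) W)
    (hW' : IsArrow (K.tensor H') (K.tensor H') W')
    (h : V * leg13 K K H W * K.amp W = K.amp W * V)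
    (h' : V * leg13 K K H' W' * K.amp W' = K.amp W' * V) :
    V * leg13 K K (H.tensor H') (W * leg13 K H H' W') * K.amp (W * leg13 K H H' W') =
      K.amp (W * leg13 K H H' W') * V := by
  set Y := leg13 K H H' W' with hY
  set θ := flip K K with hθ
  have hθθ : θ * θ = 1 := flip_flip K K
  have hW2 : IsArrow (K.tensor (H.tensor H')) (K.tensor (H.tensor H')) W := by
    rw [← tensor_assoc]; exact hW.tensor_right H'
  have hYa : IsArrow (K.tensor (H.tensor H')) (K.tensor (H.tensor H')) Y := hW'.leg13 H
  rw [leg13_eq (hW2.comp hYa)]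
  rw [leg13_eq hW] at h
  rw [leg13_eq hW'] at h'
  have hcomm : (θ * K.amp Y * θ) * K.amp W = K.amp W * (θ * K.amp Y * θ) := by
    rw [hY, hθ, leg13_tensor hW']
    exact leg13_commute hW' hW
  have hVS : ∀ S : L →L[ℂ] L, V * K.amp (K.amp S) = K.amp (K.amp S) * V := by
    intro S
    rw [← amp_tensor]
    exact hV.mul_amp S
  have hθS : ∀ S : L →L[ℂ] L, θ * K.amp (K.amp S) = K.amp (K.amp S) * θ :=
    fun S => flip_mul_amp_amp K K S
  have hfl : K.amp (K.amp (flip H H')) * K.amp (K.amp (flip H' H)) = 1 := by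
    rw [← amp_comp, ← amp_comp, flip_flip, amp_one, amp_one]
  have hYeq : K.amp Y = K.amp (K.amp (flip H' H)) * K.amp W' * K.amp (K.amp (flip H H')) := by
    rw [hY]; simp only [leg13, amp_comp]
  have hY' : V * (θ * K.amp Y * θ) * K.amp Y = K.amp Y * V := by
    set a := K.amp (K.amp (flip H' H))
    set b := K.amp (K.amp (flip H H'))
    have e1 : θ * K.amp Y * θ = a * (θ * K.amp W' * θ) * b := by
      rw [hYeq]
      calc θ * (a * K.amp W' * b) * θ = (θ * a) * K.amp W' * (b * θ) := by
            simp only [mul_assoc]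
        _ = _ := by rw [hθS, ← hθS (flip H H')]; simp only [mul_assoc]; rfl
    rw [e1, hYeq]
    calc V * (a * (θ * K.amp W' * θ) * b) * (a * K.amp W' * b)
        = (V * a) * (θ * K.amp W' * θ) * (b * a) * K.amp W' * b := by simp only [mul_assoc]
      _ = a * (V * (θ * K.amp W' * θ) * K.amp W') * b := by
          rw [hVS, hfl, mul_one]; simp only [mul_assoc]; rfl
      _ = a * K.amp W' * (V * b) := by rw [h']; simp only [mul_assoc]
      _ = a * K.amp W' * b * V := by rw [hVS]; simp only [mul_assoc]; rfl
  calc V * (θ * K.amp (W * Y) * θ) * K.amp (W * Y)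
      = V * (θ * K.amp W * (θ * θ) * K.amp Y * θ) * K.amp W * K.amp Y := by
        rw [hθθ, amp_comp]; simp only [mul_assoc, mul_one]
    _ = V * (θ * K.amp W * θ) * ((θ * K.amp Y * θ) * K.amp W) * K.amp Y := by
        simp only [mul_assoc]
    _ = (V * (θ * K.amp W * θ) * K.amp W) * (θ * K.amp Y * θ) * K.amp Y := by
        rw [hcomm]; simp only [mul_assoc]
    _ = K.amp W * (V * (θ * K.amp Y * θ) * K.amp Y) := by rw [h]; simp only [mul_assoc]
    _ = K.amp (W * Y) * V := by rw [hY', amp_comp]; simp only [mul_assoc]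

end HilbertIn

section

variable {L : Type*} [NormedAddCommGroup L] [InnerProductSpace ℂ L] [CompleteSpace L]
  {M : VonNeumannAlgebra L}

/-- A multiplicative unitary on `K²`: a unitary `V` on `K²` with `V₁₂ V₁₃ V₂₃ = V₂₃ V₁₂`. -/
structure MultiplicativeUnitary (K : HilbertIn M) where
  /-- the unitary operator on `K²` -/
  op : L →L[ℂ] L
  isArrow : HilbertIn.IsArrow (K.tensor K) (K.tensor K) op
  unitary_op : op ∈ unitary (L →L[ℂ] L)
  multiplicative : op * HilbertIn.leg13 K K K op * K.amp op = K.amp op * op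

/-- A corepresentation of `V` on a Hilbert space `H` in `M`: a unitary `W` on `K H` with
`V₁₂ W₁₃ W₂₃ = W₂₃ V₁₂` on `K² H`. -/
structure Corep {K : HilbertIn M} (V : MultiplicativeUnitary K) where
  /-- the Hilbert space of the corepresentation -/
  space : HilbertIn M
  /-- the unitary operator on `K H` -/
  op : L →L[ℂ] L
  isArrow : HilbertIn.IsArrow (K.tensor space) (K.tensor space) op
  unitary_op : op ∈ unitary (L →L[ℂ] L)
  corep : V.op * HilbertIn.leg13 K K space op * K.amp op = K.amp op * V.op

namespace Corep

variable {K : HilbertIn M} {V : MultiplicativeUnitary K}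

/-- The arrows of the category `C(V)`: `T ∈ (H, H')` with `(1_K × T) W = W' (1_K × T)`. -/
def IsIntertwiner (W W' : Corep V) (T : L →L[ℂ] L) : Prop :=
  HilbertIn.IsArrow W.space W'.space T ∧ K.amp T * W.op = W'.op * K.amp T

/-- The regular corepresentation `V` on `K`. -/
def regular (V : MultiplicativeUnitary K) : Corep V where
  space := K
  op := V.op
  isArrow := V.isArrow
  unitary_op := V.unitary_op
  corep := V.multiplicative

/-- The trivial corepresentation on `H`. -/
def trivialOn (V : MultiplicativeUnitary K) (H : HilbertIn M) : Corep V where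
  space := H
  op := 1
  isArrow := ⟨one_mem M, fun ψ hψ => by rwa [one_mul]⟩
  unitary_op := one_mem _
  corep := by
    have h : HilbertIn.leg13 K K H (1 : L →L[ℂ] L) = 1 := by
      rw [HilbertIn.leg13, mul_one, ← HilbertIn.amp_comp, HilbertIn.flip_flip, HilbertIn.amp_one]
    rw [h, HilbertIn.amp_one, mul_one, mul_one, one_mul]

/-- The tensor unit of `C(V)`. -/
def tensorUnit (V : MultiplicativeUnitary K) : Corep V :=
  trivialOn V (HilbertIn.unit M)

/-- The forgetful functor `ι` on objects; on arrows it is `T ↦ T`. -/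
def forget (W : Corep V) : Corep V := trivialOn V W.space

/-- The tensor product of corepresentations, `W × W' = W₁₂ W'₁₃` on `K H H'`. -/
noncomputable def tensor (W W' : Corep V) : Corep V where
  space := W.space.tensor W'.space
  op := W.op * HilbertIn.leg13 K W.space W'.space W'.op
  isArrow := by
    have h := W.isArrow.tensor_right W'.space
    rw [HilbertIn.tensor_assoc] at h
    exact h.comp (W'.isArrow.leg13 W.space)
  unitary_op := mul_mem W.unitary_op (HilbertIn.leg13_unitary W'.unitary_op)
  corep := HilbertIn.corep_tensor V.isArrow W.isArrow W'.isArrow W.corep W'.corep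

end Corep

/-- A full tensor subcategory of `C(V)`: a class of corepresentations containing the tensor unit
and closed under tensor products. -/
structure FullTensorSubcategory {K : HilbertIn M} (V : MultiplicativeUnitary K) where
  /-- the objects -/
  obj : Set (Corep V)
  unit_mem : Corep.tensorUnit V ∈ obj
  tensor_mem : ∀ W ∈ obj, ∀ W' ∈ obj, W.tensor W' ∈ obj

/-- The objects of the full tensor subcategory generated by the regular corepresentation. -/
inductive InGenerated {K : HilbertIn M} (V : MultiplicativeUnitary K) : Corep V → Prop
  | unit : InGenerated V (Corep.tensorUnit V)
  | regular : InGenerated V (Corep.regular V)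
  | tensor (W W' : Corep V) :
      InGenerated V W → InGenerated V W' → InGenerated V (W.tensor W')

/-- `C(V)_V`, the full tensor subcategory of `C(V)` generated by `V`. -/
def generatedSubcategory {K : HilbertIn M} (V : MultiplicativeUnitary K) :
    FullTensorSubcategory V where
  obj := {W | InGenerated V W}
  unit_mem := InGenerated.unit
  tensor_mem := fun W hW W' hW' => InGenerated.tensor W W' hW hW'

/-- `C(V)` itself. -/
def fullCategory {K : HilbertIn M} (V : MultiplicativeUnitary K) : FullTensorSubcategory V where
  obj := Set.univ
  unit_mem := trivial
  tensor_mem := fun _ _ _ _ => trivial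

/-- A braided symmetry relative to `V` on a full tensor subcategory: a natural unitary
transformation `ε` from the functor `W ↦ W × V` to the functor `W ↦ V × W` such that
`ε_{W × W'} = (ε_W × 1_{W'}) ∘ (1_W × ε_{W'})`. -/
@[ext]
structure BraidedSymmetry {K : HilbertIn M} {V : MultiplicativeUnitary K}
    (T : FullTensorSubcategory V) where
  /-- the component at an object -/
  app : ∀ W : Corep V, W ∈ T.obj → (L →L[ℂ] L)
  isIntertwiner : ∀ W (hW : W ∈ T.obj),
    Corep.IsIntertwiner (W.tensor (Corep.regular V)) ((Corep.regular V).tensor W) (app W hW)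
  unitary_app : ∀ W (hW : W ∈ T.obj), app W hW ∈ unitary (L →L[ℂ] L)
  naturality : ∀ W (hW : W ∈ T.obj) W' (hW' : W' ∈ T.obj) (S : L →L[ℂ] L),
    Corep.IsIntertwiner W W' S → app W' hW' * S = K.amp S * app W hW
  app_tensor : ∀ W (hW : W ∈ T.obj) W' (hW' : W' ∈ T.obj),
    app (W.tensor W') (T.tensor_mem W hW W' hW') = app W hW * W.space.amp (app W' hW')

/-- `(ξ, V)` is a left regular object: `ξ` is a natural unitary transformation from `W ↦ V × W` to
`W ↦ V × ι(W)` with `ξ_{W × W'} = (ξ_{W'})₁₃ ∘ (ξ_W × 1_{W'})`. -/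
structure IsLeftRegularObject {K : HilbertIn M} {V : MultiplicativeUnitary K}
    (T : FullTensorSubcategory V) (ξ : ∀ W : Corep V, W ∈ T.obj → (L →L[ℂ] L)) : Prop where
  isIntertwiner : ∀ W (hW : W ∈ T.obj),
    Corep.IsIntertwiner ((Corep.regular V).tensor W) ((Corep.regular V).tensor W.forget) (ξ W hW)
  unitary_app : ∀ W (hW : W ∈ T.obj), ξ W hW ∈ unitary (L →L[ℂ] L)
  naturality : ∀ W (hW : W ∈ T.obj) W' (hW' : W' ∈ T.obj) (S : L →L[ℂ] L),
    Corep.IsIntertwiner W W' S → ξ W' hW' * K.amp S = K.amp S * ξ W hW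
  app_tensor : ∀ W (hW : W ∈ T.obj) W' (hW' : W' ∈ T.obj),
    ξ (W.tensor W') (T.tensor_mem W hW W' hW') =
      HilbertIn.leg13 K W.space W'.space (ξ W' hW') * ξ W hW

/-- `(V, η)` is a right regular object: `η` is a natural unitary transformation from `W ↦ W × V` to
`W ↦ ι(W) × V` with `η_{W × W'} = (η_W)₁₃ ∘ (1_W × η_{W'})`. -/
structure IsRightRegularObject {K : HilbertIn M} {V : MultiplicativeUnitary K}
    (T : FullTensorSubcategory V) (η : ∀ W : Corep V, W ∈ T.obj → (L →L[ℂ] L)) : Prop where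
  isIntertwiner : ∀ W (hW : W ∈ T.obj),
    Corep.IsIntertwiner (W.tensor (Corep.regular V)) (W.forget.tensor (Corep.regular V)) (η W hW)
  unitary_app : ∀ W (hW : W ∈ T.obj), η W hW ∈ unitary (L →L[ℂ] L)
  naturality : ∀ W (hW : W ∈ T.obj) W' (hW' : W' ∈ T.obj) (S : L →L[ℂ] L),
    Corep.IsIntertwiner W W' S → η W' hW' * S = S * η W hW
  app_tensor : ∀ W (hW : W ∈ T.obj) W' (hW' : W' ∈ T.obj),
    η (W.tensor W') (T.tensor_mem W hW W' hW') =
      HilbertIn.leg13 W.space W'.space K (η W hW) * W.space.amp (η W' hW')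

namespace BraidedSymmetry

variable {K : HilbertIn M} {V : MultiplicativeUnitary K} {T : FullTensorSubcategory V}

/-- `ξ_W = W⁻¹`, the transformation making the regular corepresentation left regular. -/
noncomputable def xi (T : FullTensorSubcategory V) (W : Corep V) (_ : W ∈ T.obj) : L →L[ℂ] L :=
  star W.op

/-- `η_W = θ_W⁻¹ ξ_W ε_W`, where `θ_W` is the flip from `ι(W) × V` to `V × ι(W)`. -/
noncomputable def eta (ε : BraidedSymmetry T) (W : Corep V) (hW : W ∈ T.obj) : L →L[ℂ] L :=
  star (HilbertIn.flip W.space K) * xi T W hW * ε.app W hW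

/-- The braided symmetry `ε` is standard: `(ξ, V)` is left regular, `(V, η)` is right regular and
`(η_W × 1_{ι(W')}) ∘ (1_W × ξ_{W'}) = (1_{ι(W)} × ξ_{W'}) ∘ (η_W × 1_{W'})`. -/
structure IsStandard (ε : BraidedSymmetry T) : Prop where
  left_regular : IsLeftRegularObject T (xi T)
  right_regular : IsRightRegularObject T ε.eta
  commutation : ∀ W (hW : W ∈ T.obj) W' (hW' : W' ∈ T.obj),
    ε.eta W hW * W.space.amp (xi T W' hW') = W.space.amp (xi T W' hW') * ε.eta W hW

/-- `ε` on `C(V)` extends `ε₀`. -/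
def Extends (ε : BraidedSymmetry (fullCategory V)) (ε₀ : BraidedSymmetry T) : Prop :=
  ∀ W (hW : W ∈ T.obj), ε.app W trivial = ε₀.app W hW

end BraidedSymmetry

namespace MultiplicativeUnitary

variable {K : HilbertIn M}

/-- `V^d = ϑ V⁻¹ ϑ` -/
noncomputable def dualOp (V : MultiplicativeUnitary K) : L →L[ℂ] L :=
  HilbertIn.flip K K * star V.op * HilbertIn.flip K K

/-- `(X, X)` for an operator `X` on `K²`: the `S ∈ (K, K)` with `(1_K × S) X = X (1_K × S)`. -/
def selfIntertwiners (K : HilbertIn M) (X : L →L[ℂ] L) : Set (L →L[ℂ] L) :=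
  {S | HilbertIn.IsArrow K K S ∧ K.amp S * X = X * K.amp S}

/-- A set of operators on `K` acts irreducibly on `K`: the only closed linear subspaces of `K`
invariant under it are `0` and `K`. -/
def ActsIrreducibly (K : HilbertIn M) (A : Set (L →L[ℂ] L)) : Prop :=
  ∀ E : Submodule ℂ (L →L[ℂ] L), E ≤ K.carrier → IsClosed (E : Set (L →L[ℂ] L)) →
    (∀ S ∈ A, ∀ ψ ∈ E, S * ψ ∈ E) → E = ⊥ ∨ E = K.carrier

/-- The algebra generated by `(V, V)` and `(V^d, V^d)`. -/
def generatedAlgebra (V : MultiplicativeUnitary K) : Subalgebra ℂ (L →L[ℂ] L) :=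
  Algebra.adjoin ℂ (selfIntertwiners K V.op ∪ selfIntertwiners K V.dualOp)

end MultiplicativeUnitary

end

/-! A braided symmetry is determined by its component `e` at the regular corepresentation $V$. For a
corepresentation $W$ on $H$ and $\varphi\in H$, the corepresentation identity says that $\psi\mapsto
W\psi\varphi$ is an arrow from $V$ to $V\times W$ (`Corep.absorb`). Naturality along it, together
with $\varepsilon_{V\times W}=\varepsilon_V(1_K\times\varepsilon_W)$, gives
$(1_K\times\varepsilon_W)\,a_\varphi=e^*(1_K\times a_\varphi)\,e$, where $a_\varphi$ is this arrow.
Since $W$ is unitary, the ranges of the $a_\varphi$ are jointly total, so the identity determines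
$\varepsilon_W$. This gives uniqueness, and it shows that whatever is built on $\mathcal C(V)$ from
`e` agrees with the given symmetry on $\mathcal C(V)_V$.

For existence, the identity can be solved by an explicit unitary $X_W$ (`ampComponent`) from $KHK$
to $KKH$; the question is whether $X_W$ has the form $1_K\times Y$. By Schur's lemma
(`exists_amp_eq_of_commute`) it suffices that $X_W$ commutes with $(V,V)$ and $(V^d,V^d)$ acting on
the first factor. For $(V,V)$ this follows from naturality of `e`. An operator $S\in(V^d,V^d)$ is
one on the first factor that commutes with $V$, hence with every $W$. The identity at $W=V$ reads
$e^*(1_K\times V)e=(1_K\times e)V(1_K\times\vartheta)$, whose right side commutes with $S$. So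
$eSe^*$ commutes with $1_K\times V$, hence with $1_K\times W$, which is what is needed. The axioms
for $Y$ are then checked against the arrows $a_\varphi$.

For standardness, everything except the commutation relation and the tensor formula for $\eta$ is
automatic, and the tensor formula follows from the commutation relation. That relation reduces to
its instance at $V$: if $\eta_V$ commutes with $1_K\times V$, then $(1_K\times W)^*e^*(1_K\times
W)e=\eta_V^*W_{13}\eta_V$ commutes with $V_{24}$, which yields the relation for $\eta_W$
(`BraidedSymmetry.eta_commute`). Since $\eta_V$ depends only on `e`, standardness passes to the
extension. -/

theorem mul_star_comm_of_mul_comm {R : Type*} [Monoid R] [StarMul R] {U B : R} (hU : U ∈ unitary R)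
    (h : B * U = U * B) : B * star U = star U * B := by
  calc B * star U = star U * (U * B) * star U := by
        rw [← mul_assoc, Unitary.star_mul_self_of_mem hU, one_mul]
    _ = star U * B := by
        rw [← h, mul_assoc, mul_assoc, Unitary.mul_star_self_of_mem hU, mul_one]

/-! ### Arrows between Hilbert spaces in $M$: adjoints, slices and flips. -/

namespace HilbertIn

variable {L : Type*} [NormedAddCommGroup L] [InnerProductSpace ℂ L] [CompleteSpace L]
  {M : VonNeumannAlgebra L}

/-- A Hilbert space in `M` contains every operator whose inner products with it are scalars. -/
theorem mem_of_star_mul_scalar (H : HilbertIn M) {a : L →L[ℂ] L}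
    (h : ∀ ψ ∈ H.carrier, ∃ c : ℂ, star ψ * a = c • (1 : L →L[ℂ] L)) : a ∈ H.carrier := by
  rcases subsingleton_or_nontrivial L with hL | hL
  · rw [show a = 0 from ContinuousLinearMap.ext fun x => Subsingleton.elim _ _]
    exact zero_mem _
  obtain ⟨x, hx⟩ := exists_norm_eq L (zero_le_one (α := ℝ))
  have hadj : ∀ (A B : L →L[ℂ] L), ⟪A x, B x⟫_ℂ = ⟪x, (star A * B) x⟫_ℂ := by
    intro A B
    rw [mul_apply_eq_comp, ContinuousLinearMap.star_eq_adjoint,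
      ContinuousLinearMap.adjoint_inner_right]
  have hxx : ⟪x, x⟫_ℂ = 1 := by rw [inner_self_eq_norm_sq_to_K, hx]; simp
  -- Evaluation at a unit vector embeds $H$ isometrically in $L$; the candidate for $a$ is the
  -- vector of $H$ whose image is the orthogonal projection of $ax$ onto the range.
  let f : H.carrier →ₗᵢ[ℂ] L :=
    { toFun := fun ψ => (ψ : L →L[ℂ] L) x
      map_add' := fun ψ φ => rfl
      map_smul' := fun c ψ => rfl
      norm_map' := fun ψ => by
        change ‖(ψ : L →L[ℂ] L) x‖ = ‖(ψ : L →L[ℂ] L)‖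
        obtain ⟨c, hc⟩ := H.inner_scalar ψ ψ.2 ψ ψ.2
        have h1 : ‖(ψ : L →L[ℂ] L)‖ * ‖(ψ : L →L[ℂ] L)‖ = ‖c‖ := by
          rw [← CStarRing.norm_star_mul_self, hc, norm_smul, norm_one, mul_one]
        have h2 : ‖(ψ : L →L[ℂ] L) x‖ * ‖(ψ : L →L[ℂ] L) x‖ = ‖c‖ := by
          have h3 := congrArg norm (hadj ψ ψ)
          rw [inner_self_eq_norm_sq_to_K, hc, smul_apply, one_apply_eq_self, inner_smul_right,
            hxx, mul_one] at h3
          rw [← h3]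
          simp [pow_two]
        nlinarith [norm_nonneg ((ψ : L →L[ℂ] L) x), norm_nonneg (ψ : L →L[ℂ] L)] }
  let E : Submodule ℂ L := LinearMap.range f.toLinearMap
  have : CompleteSpace H.carrier := H.isClosed.completeSpace_coe
  have hE : IsComplete (E : Set L) := by
    have : (E : Set L) = Set.range f := rfl
    rw [this, ← Set.image_univ]
    exact (LinearIsometry.isComplete_image_iff f).2 isComplete_univ
  have : CompleteSpace E := hE.completeSpace_coe
  obtain ⟨χ, hχ⟩ : ∃ χ : H.carrier, f χ = E.starProjection (a x) :=
    (E.starProjection_apply_mem (a x))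
  have key : a = χ := by
    refine H.star_mul_ext fun ψ hψ => ?_
    obtain ⟨c, hc⟩ := h ψ hψ
    obtain ⟨d, hd⟩ := H.inner_scalar ψ hψ χ χ.2
    have h0 : ⟪ψ x, a x - f χ⟫_ℂ = 0 := by
      rw [hχ]
      exact E.inner_right_of_mem_orthogonal (u := ψ x) ⟨⟨ψ, hψ⟩, rfl⟩
        (E.sub_starProjection_mem_orthogonal (a x))
    rw [inner_sub_right] at h0
    change ⟪ψ x, a x⟫_ℂ - ⟪ψ x, (χ : L →L[ℂ] L) x⟫_ℂ = 0 at h0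
    rw [hadj, hadj, hc, hd, smul_apply, smul_apply, one_apply_eq_self, inner_smul_right,
      inner_smul_right, hxx, mul_one, mul_one] at h0
    rw [hc, hd, sub_eq_zero.1 h0]
  rw [key]
  exact χ.2

/-- An operator commuting with all `1_H × S` leaves `H` invariant. -/
theorem mul_mem_of_commute_amp (H : HilbertIn M) {R : L →L[ℂ] L}
    (h : ∀ S, R * H.amp S = H.amp S * R) {ψ : L →L[ℂ] L} (hψ : ψ ∈ H.carrier) :
    R * ψ ∈ H.carrier := by
  refine H.mem_of_star_mul_scalar fun φ hφ => ?_
  -- The inner product $\varphi^*R\psi$ commutes with every bounded operator on $L$, and the centre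
  -- of that algebra consists of the scalars.
  have hc : star φ * (R * ψ) ∈ Subalgebra.center ℂ (L →L[ℂ] L) := by
    rw [Subalgebra.mem_center_iff]
    intro S
    calc S * (star φ * (R * ψ)) = (S * star φ) * R * ψ := by simp only [mul_assoc]
      _ = star φ * (H.amp S * R) * ψ := by rw [← H.star_mul_amp S hφ]; simp only [mul_assoc]
      _ = star φ * R * (H.amp S * ψ) := by rw [← h]; simp only [mul_assoc]
      _ = star φ * (R * ψ) * S := by rw [H.amp_mul S hψ]; simp only [mul_assoc]
  rw [Algebra.IsCentral.center_eq_bot] at hc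
  obtain ⟨c, hc⟩ := Algebra.mem_bot.1 hc
  exact ⟨c, by rw [← hc, Algebra.algebraMap_eq_smul_one]⟩

/-- The inner products $\varphi^*(T^*\psi)=(T\varphi)^*\psi$ are scalars, which is enough for
$T^*\psi$ to lie in $H$. -/
theorem IsArrow.star {H H' : HilbertIn M} {T : L →L[ℂ] L} (hT : IsArrow H H' T) :
    IsArrow H' H (star T) :=
  ⟨star_mem hT.1, fun ψ hψ => H.mem_of_star_mul_scalar fun φ hφ => by
    rw [← mul_assoc, ← star_mul]
    exact H'.inner_scalar _ (hT.2 φ hφ) ψ hψ⟩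

theorem isArrow_flip (B C : HilbertIn M) : IsArrow (B.tensor C) (C.tensor B) (flip B C) := by
  refine ⟨flip_mem B C, fun a ha => ?_⟩
  refine tensor_induction B C (p := fun a => flip B C * a ∈ (C.tensor B).carrier)
    (fun ψ hψ φ hφ => ?_) (fun _ _ h h' => by rw [mul_add]; exact add_mem h h')
    ((C.tensor B).isClosed.preimage (f := fun d : L →L[ℂ] L => flip B C * d) (by fun_prop)) ha
  rw [flip_mul_mul _ _ hψ hφ]
  exact mul_mem_tensor _ _ hφ hψ

/-- Left multiplication by `ψ ∈ A` is an arrow from `H` to `A H`. -/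
theorem isArrow_of_mem {A : HilbertIn M} (H : HilbertIn M) {ψ : L →L[ℂ] L} (hψ : ψ ∈ A.carrier) :
    IsArrow H (A.tensor H) ψ :=
  ⟨A.mem_algebra ψ hψ, fun _ hφ => mul_mem_tensor A H hψ hφ⟩

/-- For `φ ∈ H`, the operator `ψ ↦ ψ φ` is an arrow from `A` to `A H`. -/
theorem isArrow_amp_of_mem (A : HilbertIn M) {H : HilbertIn M} {φ : L →L[ℂ] L}
    (hφ : φ ∈ H.carrier) : IsArrow A (A.tensor H) (A.amp φ) :=
  ⟨A.amp_mem (H.mem_algebra φ hφ), fun ψ hψ => by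
    rw [A.amp_mul _ hψ]; exact mul_mem_tensor A H hψ hφ⟩

/-- Such a pair lets one cancel a tensor factor by compressing with $\psi^*$ and $\chi$. Only
$\psi^*\chi=1$ is needed, so $\chi$ is a rescaled $\psi$ and no square root is taken. -/
theorem exists_star_mul_eq_one [Nontrivial L] (H : HilbertIn M) :
    ∃ ψ ∈ H.carrier, ∃ χ ∈ H.carrier, star ψ * χ = 1 := by
  obtain ⟨ψ, hψ, hne⟩ : ∃ ψ ∈ H.carrier, ψ ≠ 0 := by
    by_contra! h
    have : (1 : L →L[ℂ] L) = 0 := H.op_ext fun ψ hψ => by rw [h ψ hψ]; simp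
    exact one_ne_zero this
  obtain ⟨c, hc⟩ := H.inner_scalar ψ hψ ψ hψ
  have h0 : c ≠ 0 := by
    rintro rfl
    rw [zero_smul, CStarRing.star_mul_self_eq_zero_iff] at hc
    exact hne hc
  exact ⟨ψ, hψ, c⁻¹ • ψ, H.carrier.smul_mem _ hψ, by
    rw [mul_smul_comm, hc, smul_smul, inv_mul_cancel₀ h0, one_smul]⟩

theorem amp_injective (H : HilbertIn M) : Function.Injective H.amp := by
  intro S T h
  rcases subsingleton_or_nontrivial L with hL | hL
  · exact ContinuousLinearMap.ext fun x => Subsingleton.elim _ _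
  obtain ⟨ψ, -, χ, hχ, h1⟩ := H.exists_star_mul_eq_one
  have h2 : star ψ * (χ * S) = star ψ * (χ * T) := by
    rw [← H.amp_mul S hχ, ← H.amp_mul T hχ, h]
  rwa [← mul_assoc, ← mul_assoc, h1, one_mul, one_mul] at h2

/-- The operators on `A H` are separated by composition with the maps `ψ ↦ ψ φ`, `φ ∈ H`. -/
theorem amp_op_ext (A H : HilbertIn M) {S T : L →L[ℂ] L}
    (h : ∀ φ ∈ H.carrier, S * A.amp φ = T * A.amp φ) : S = T :=
  op_ext₂ A H fun ψ hψ φ hφ => by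
    rw [← A.amp_mul φ hψ, ← mul_assoc, h φ hφ, mul_assoc]

theorem amp_star_mul_ext (A H : HilbertIn M) {S T : L →L[ℂ] L}
    (h : ∀ φ ∈ H.carrier, A.amp (star φ) * S = A.amp (star φ) * T) : S = T := by
  apply star_injective
  refine A.amp_op_ext H fun φ hφ => ?_
  have := congrArg star (h φ hφ)
  rwa [star_mul, star_mul, ← amp_star, star_star] at this

theorem flip_mul_amp (H H' : HilbertIn M) {φ : L →L[ℂ] L} (hφ : φ ∈ H'.carrier) :
    flip H H' * H.amp φ = φ :=
  H.op_ext fun ψ hψ => by rw [mul_assoc, H.amp_mul _ hψ, flip_mul_mul _ _ hψ hφ]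

theorem amp_star_mul_flip (H H' : HilbertIn M) {ψ : L →L[ℂ] L} (hψ : ψ ∈ H.carrier) :
    H'.amp (star ψ) * flip H H' = star ψ := by
  rw [amp_star, ← star_star (flip H H'), ← star_mul, flip_star, flip_mul_amp _ _ hψ]

theorem flip_mul_arrow {H H₁ : HilbertIn M} (A : HilbertIn M) {S : L →L[ℂ] L}
    (hS : IsArrow H H₁ S) : flip H₁ A * S = A.amp S * flip H A :=
  op_ext₂ H A fun ψ hψ φ hφ => by
    rw [mul_assoc, ← mul_assoc S, flip_mul_mul _ _ (hS.2 ψ hψ) hφ, mul_assoc,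
      flip_mul_mul _ _ hψ hφ, A.amp_mul_assoc _ hφ]

theorem flip_mul_amp_arrow {H H₁ : HilbertIn M} (A : HilbertIn M) {S : L →L[ℂ] L}
    (hS : IsArrow H H₁ S) : flip A H₁ * A.amp S = S * flip A H :=
  op_ext₂ A H fun φ hφ ψ hψ => by
    rw [mul_assoc, A.amp_mul_assoc _ hφ, flip_mul_mul _ _ hφ (hS.2 ψ hψ), mul_assoc S ψ,
      mul_assoc S,
      flip_mul_mul _ _ hφ hψ]

/-- `X₁₃` is characterised by `X₁₃ (1_A × β) = (1_A × β) X` for `β ∈ B`. -/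
theorem leg13_mul_amp {A B C : HilbertIn M} {X : L →L[ℂ] L}
    (hX : IsArrow (A.tensor C) (A.tensor C) X) {β : L →L[ℂ] L} (hβ : β ∈ B.carrier) :
    leg13 A B C X * A.amp β = A.amp β * X := by
  have h1 : A.amp (flip B C) * A.amp β = A.amp (C.amp β) := by rw [← amp_comp, flip_mul _ _ hβ]
  have h2 : A.amp (flip C B) * A.amp (C.amp β) = A.amp β := by rw [← amp_comp, flip_mul_amp _ _ hβ]
  have h3 : X * A.amp (C.amp β) = A.amp (C.amp β) * X := by rw [← amp_tensor, hX.mul_amp]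
  rw [leg13, mul_assoc, h1, mul_assoc, h3, ← mul_assoc, h2]

/-! ### Schur's lemma for operators on $K$ and on $K\otimes H$. -/

/-- The continuous functional calculus preserves invariance of a Hilbert space in `M`. -/
theorem cfc_mul_mem {H : HilbertIn M} {T : L →L[ℂ] L} (hT : IsArrow H H T) (f : ℝ → ℝ)
    {ψ : L →L[ℂ] L} (hψ : ψ ∈ H.carrier) : cfc f T * ψ ∈ H.carrier :=
  H.mul_mem_of_commute_amp
    (fun S => (Commute.cfc_real (show Commute T (H.amp S) from hT.mul_amp S) f).eq) hψ

/-- Schur's lemma for self-adjoint operators. -/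
theorem exists_eq_smul_of_isSelfAdjoint {K : HilbertIn M} {G : Set (L →L[ℂ] L)}
    (hG : MultiplicativeUnitary.ActsIrreducibly K G) (hGK : ∀ S ∈ G, IsArrow K K S)
    {T : L →L[ℂ] L} (hT : IsArrow K K T)
    (hsa : IsSelfAdjoint T) (hcomm : ∀ S ∈ G, T * S = S * T) :
    ∃ r : ℝ, T = algebraMap ℝ (L →L[ℂ] L) r := by
  rcases subsingleton_or_nontrivial L with hL | hL
  · exact ⟨0, ContinuousLinearMap.ext fun x => Subsingleton.elim _ _⟩
  obtain ⟨a, ha⟩ : (spectrum ℝ T).Nonempty := ContinuousFunctionalCalculus.spectrum_nonempty T hsa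
  by_cases hs : spectrum ℝ T ⊆ {a}
  · exact ⟨a, CFC.eq_algebraMap_of_spectrum_subset_singleton T a hs⟩
  exfalso
  obtain ⟨b, hb, hba⟩ := Set.not_subset.1 hs
  rw [Set.mem_singleton_iff] at hba
  -- Two spectral points would split $K$: `f` and `g` live on opposite sides of the midpoint, so
  -- $f(T)g(T)=0$ with both factors nonzero. The kernel of $f(T)$ in $K$ is then closed and
  -- invariant, contains the range of $g(T)$ on $K$, and is not all of $K$.
  have key : ∀ a b : ℝ, a ∈ spectrum ℝ T → b ∈ spectrum ℝ T → a < b → False := by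
    intro a b ha hb hab
    let m := (a + b) / 2
    let f : ℝ → ℝ := fun x => max (m - x) 0
    let g : ℝ → ℝ := fun x => max (x - m) 0
    have hf : Continuous f := by fun_prop
    have hg : Continuous g := by fun_prop
    have hne : ∀ (h : ℝ → ℝ), Continuous h → ∀ x ∈ spectrum ℝ T, h x ≠ 0 → cfc h T ≠ 0 := by
      intro h hh x hx hx0 h0
      have h1 : h x ∈ spectrum ℝ (cfc h T) := by
        rw [cfc_map_spectrum h T]
        exact ⟨x, hx, rfl⟩
      rw [h0, spectrum.zero_eq] at h1
      exact hx0 h1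
    have hf0 : cfc f T ≠ 0 := hne f hf a ha (by
      have : 0 < m - a := by simp only [m]; linarith
      exact (lt_max_of_lt_left this).ne')
    have hg0 : cfc g T ≠ 0 := hne g hg b hb (by
      have : 0 < b - m := by simp only [m]; linarith
      exact (lt_max_of_lt_left this).ne')
    have hfg : cfc f T * cfc g T = 0 := by
      rw [← cfc_mul f g T hf.continuousOn hg.continuousOn, ← cfc_zero ℝ T]
      congr 1
      funext x
      simp only [f, g, Pi.zero_apply]
      rcases le_total x m with h | h
      · rw [max_eq_right (a := x - m) (by linarith), mul_zero]
      · rw [max_eq_right (a := m - x) (by linarith), zero_mul]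
    let E : Submodule ℂ (L →L[ℂ] L) :=
      K.carrier ⊓ LinearMap.ker (LinearMap.mulLeft ℂ (cfc f T))
    have hmem : ∀ ψ, ψ ∈ E ↔ ψ ∈ K.carrier ∧ cfc f T * ψ = 0 := fun ψ => by
      simp [E, Submodule.mem_inf]
    have hcl : IsClosed (E : Set (L →L[ℂ] L)) := by
      have : (E : Set (L →L[ℂ] L)) = (K.carrier : Set (L →L[ℂ] L)) ∩
          {ψ | cfc f T * ψ = 0} := Set.ext hmem
      rw [this]
      exact K.isClosed.inter (isClosed_eq (by fun_prop) continuous_const)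
    have hinv : ∀ S ∈ G, ∀ ψ ∈ E, S * ψ ∈ E := by
      intro S hS ψ hψ
      rw [hmem] at hψ ⊢
      refine ⟨(hGK S hS).2 ψ hψ.1, ?_⟩
      have h1 : cfc f T * S = S * cfc f T :=
        (Commute.cfc_real (show Commute T S from hcomm S hS) f).eq
      rw [← mul_assoc, h1, mul_assoc, hψ.2, mul_zero]
    rcases hG E inf_le_left hcl hinv with h | h
    · refine hg0 (K.op_ext fun ψ hψ => ?_)
      have h1 : cfc g T * ψ ∈ E := by
        rw [hmem]
        exact ⟨cfc_mul_mem hT g hψ, by rw [← mul_assoc, hfg, zero_mul]⟩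
      rw [h, Submodule.mem_bot] at h1
      rw [h1, zero_mul]
    · refine hf0 (K.op_ext fun ψ hψ => ?_)
      rw [← h, hmem] at hψ
      rw [hψ.2, zero_mul]
  rcases lt_or_gt_of_ne hba with h | h
  · exact key b a hb ha h
  · exact key a b ha hb h

/-- Schur's lemma: an arrow of `K` commuting with an irreducible self-adjoint set of arrows is a
scalar. -/
theorem exists_eq_smul_of_commute {K : HilbertIn M} {G : Set (L →L[ℂ] L)}
    (hG : MultiplicativeUnitary.ActsIrreducibly K G) (hGK : ∀ S ∈ G, IsArrow K K S)
    (hstar : ∀ S ∈ G, star S ∈ G) {T : L →L[ℂ] L} (hT : IsArrow K K T)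
    (hcomm : ∀ S ∈ G, T * S = S * T) : ∃ c : ℂ, T = c • (1 : L →L[ℂ] L) := by
  have hcomm' : ∀ S ∈ G, star T * S = S * star T := fun S hS => by
    simpa using (congrArg star (hcomm (star S) (hstar S hS))).symm
  have hadd : ∀ A B : L →L[ℂ] L, IsArrow K K A → IsArrow K K B → IsArrow K K (A + B) :=
    fun A B hA hB => ⟨add_mem hA.1 hB.1, fun ψ hψ => by
      rw [add_mul]; exact add_mem (hA.2 ψ hψ) (hB.2 ψ hψ)⟩
  have hsmul : ∀ (c : ℂ) (A : L →L[ℂ] L), IsArrow K K A → IsArrow K K (c • A) :=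
    fun c A hA => ⟨M.toStarSubalgebra.smul_mem hA.1 c, fun ψ hψ => by
      rw [smul_mul_assoc]; exact K.carrier.smul_mem c (hA.2 ψ hψ)⟩
  obtain ⟨r, hr⟩ := exists_eq_smul_of_isSelfAdjoint hG hGK (hadd _ _ hT hT.star)
    (IsSelfAdjoint.add_star_self T)
    (fun S hS => by rw [add_mul, mul_add, hcomm S hS, hcomm' S hS])
  -- The other self-adjoint combination $iT-iT^*$; then $2T=(T+T^*)-i(iT-iT^*)$.
  obtain ⟨s, hs⟩ := exists_eq_smul_of_isSelfAdjoint hG hGK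
    (hadd _ _ (hsmul Complex.I _ hT) (hsmul (-Complex.I) _ hT.star))
    (by
      rw [IsSelfAdjoint, star_add, star_smul, star_smul, star_star, add_comm]
      simp)
    (fun S hS => by
      rw [add_mul, mul_add, smul_mul_assoc, smul_mul_assoc, hcomm S hS, hcomm' S hS,
        mul_smul_comm, mul_smul_comm])
  rw [Algebra.algebraMap_eq_smul_one, ← Complex.coe_smul] at hr hs
  refine ⟨(1 / 2 : ℂ) * (r - Complex.I * s), ?_⟩
  have h : T = (1 / 2 : ℂ) • ((T + star T) -
      Complex.I • (Complex.I • T + (-Complex.I) • star T)) := by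
    rw [smul_add, smul_smul, smul_smul, Complex.I_mul_I, mul_neg, Complex.I_mul_I]
    module
  rw [h, hr, hs]
  module

/-- An arrow from `K H₁` to `K H₂` commuting with an irreducible self-adjoint set of arrows of `K`
is of the form `1_K × Y`. -/
theorem exists_amp_eq_of_commute {K : HilbertIn M} {G : Set (L →L[ℂ] L)}
    (hG : MultiplicativeUnitary.ActsIrreducibly K G) (hGK : ∀ S ∈ G, IsArrow K K S)
    (hstar : ∀ S ∈ G, star S ∈ G) {H₁ H₂ : HilbertIn M} {X : L →L[ℂ] L}
    (hX : IsArrow (K.tensor H₁) (K.tensor H₂) X) (hcomm : ∀ S ∈ G, X * S = S * X) :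
    ∃ Y, IsArrow H₁ H₂ Y ∧ K.amp Y = X := by
  rcases subsingleton_or_nontrivial L with hL | hL
  · exact ⟨0, ⟨zero_mem M, fun ψ _ => by rw [zero_mul]; exact zero_mem _⟩,
      ContinuousLinearMap.ext fun x => Subsingleton.elim _ _⟩
  obtain ⟨ψ₀, hψ₀, χ₀, hχ₀, h₀⟩ := K.exists_star_mul_eq_one
  -- If $X=1_K\times Y$, compressing the first factor by a pair with $\psi_0^*\chi_0=1$ returns $Y$.
  refine ⟨star ψ₀ * X * χ₀,
    ((isArrow_of_mem H₂ hψ₀).star.comp hX).comp (isArrow_of_mem H₁ hχ₀), ?_⟩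
  refine K.op_ext fun χ hχ => K.star_mul_ext fun ψ hψ => ?_
  refine H₂.star_mul_ext fun φ' hφ' => H₁.op_ext fun φ hφ => ?_
  -- Compressing the other factor gives an operator on $K$ that still commutes with `G`, hence a
  -- scalar $c$. So the matrix coefficients of $X$ are $c\,\psi^*\chi$ with $c$ depending only on
  -- $\varphi,\varphi'$.
  have hT : IsArrow K K (K.amp (star φ') * X * K.amp φ) := by
    rw [amp_star]
    exact ((isArrow_amp_of_mem K hφ').star.comp hX).comp (isArrow_amp_of_mem K hφ)
  obtain ⟨c, hc⟩ := exists_eq_smul_of_commute hG hGK hstar hT (fun S hS => by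
    have h1 := (hGK S hS).mul_amp φ
    have h2 := (hGK S hS).mul_amp (star φ')
    rw [mul_assoc, ← h1, ← mul_assoc, mul_assoc _ X S, hcomm S hS, ← mul_assoc, ← h2]
    simp only [mul_assoc])
  have key : ∀ ψ ∈ K.carrier, ∀ χ ∈ K.carrier,
      star φ' * (star ψ * X * χ) * φ = c • (star ψ * χ) := by
    intro ψ hψ χ hχ
    calc star φ' * (star ψ * X * χ) * φ = (star φ' * star ψ) * X * (χ * φ) := by
          simp only [mul_assoc]
      _ = star ψ * (K.amp (star φ') * X * K.amp φ) * χ := by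
          rw [← K.star_mul_amp _ hψ, ← K.amp_mul _ hχ]; simp only [mul_assoc]
      _ = c • (star ψ * χ) := by rw [hc]; simp
  obtain ⟨d, hd⟩ := K.inner_scalar ψ hψ χ hχ
  rw [K.amp_mul _ hχ, ← mul_assoc (star ψ) χ, ← mul_assoc (star ψ) X, key ψ hψ χ hχ, hd]
  rw [smul_mul_assoc, one_mul, mul_smul_comm, smul_mul_assoc, key ψ₀ hψ₀ χ₀ hχ₀, h₀, smul_comm]

/-- A set acts irreducibly if the algebra generated by it does. -/
theorem actsIrreducibly_of_adjoin {K : HilbertIn M} {G : Set (L →L[ℂ] L)}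
    (h : MultiplicativeUnitary.ActsIrreducibly K (Algebra.adjoin ℂ G : Set (L →L[ℂ] L))) :
    MultiplicativeUnitary.ActsIrreducibly K G := by
  intro E hE hcl hinv
  refine h E hE hcl fun S hS => ?_
  induction hS using Algebra.adjoin_induction with
  | mem S hS => exact hinv S hS
  | algebraMap c =>
    intro ψ hψ
    rw [Algebra.algebraMap_eq_smul_one, smul_mul_assoc, one_mul]
    exact E.smul_mem c hψ
  | add S T _ _ hS hT =>
    intro ψ hψ
    rw [add_mul]
    exact add_mem (hS ψ hψ) (hT ψ hψ)
  | mul S T _ _ hS hT =>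
    intro ψ hψ
    rw [mul_assoc]
    exact hS _ (hT ψ hψ)

/-! ### Compatibility of leg numbering with arrows and flips. -/

/-- `X₁₃` intertwines arrows between the middle factors. -/
theorem leg13_naturality {A B B' C : HilbertIn M} {X T : L →L[ℂ] L}
    (hX : IsArrow (A.tensor C) (A.tensor C) X) (hT : IsArrow B B' T) :
    A.amp T * leg13 A B C X = leg13 A B' C X * A.amp T :=
  A.amp_op_ext B fun φ hφ => by
    rw [mul_assoc, leg13_mul_amp hX hφ, mul_assoc, ← A.amp_comp, ← mul_assoc, ← A.amp_comp,
      leg13_mul_amp hX (hT.2 φ hφ)]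

theorem leg13_one (A B C : HilbertIn M) : leg13 A B C (1 : L →L[ℂ] L) = 1 := by
  rw [leg13, mul_one, ← amp_comp, flip_flip, amp_one]

/-- Conjugating `X₁₃` by the flip of the first two factors gives `X₂₃`. -/
theorem flip_mul_leg13 {A B C : HilbertIn M} {X : L →L[ℂ] L}
    (hX : IsArrow (A.tensor C) (A.tensor C) X) :
    flip A B * leg13 A B C X = B.amp X * flip A B :=
  A.amp_op_ext B fun φ hφ => by
    rw [mul_assoc, leg13_mul_amp hX hφ, ← mul_assoc, flip_mul_amp _ _ hφ, mul_assoc,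
      flip_mul_amp _ _ hφ, B.amp_mul _ hφ]

end HilbertIn

section

variable {L : Type*} [NormedAddCommGroup L] [InnerProductSpace ℂ L] [CompleteSpace L]
  {M : VonNeumannAlgebra L} {K : HilbertIn M} {V : MultiplicativeUnitary K}

open HilbertIn

/-! ### The self-intertwiners of $V$ and of its dual. -/

namespace MultiplicativeUnitary

/-- Schur's lemma is applied to a self-adjoint set of arrows; unitarity of `X` provides it. -/
theorem star_mem_selfIntertwiners {X S : L →L[ℂ] L} (hX : X ∈ unitary (L →L[ℂ] L))
    (hS : S ∈ selfIntertwiners K X) : star S ∈ selfIntertwiners K X := by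
  refine ⟨hS.1.star, ?_⟩
  have h : star X * K.amp S = K.amp S * star X := by
    calc star X * K.amp S = star X * (K.amp S * X) * star X := by
          rw [mul_assoc, mul_assoc, Unitary.mul_star_self_of_mem hX, mul_one]
      _ = K.amp S * star X := by
          rw [hS.2, ← mul_assoc, Unitary.star_mul_self_of_mem hX, one_mul]
  simpa [amp_star] using congrArg star h

theorem dualOp_unitary (V : MultiplicativeUnitary K) : V.dualOp ∈ unitary (L →L[ℂ] L) :=
  mul_mem (mul_mem (flip_unitary K K) (Unitary.star_mem V.unitary_op)) (flip_unitary K K)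

/-- The arrows of the dual regular corepresentation are the operators on the first factor commuting
with `V`. -/
theorem mem_selfIntertwiners_dualOp_iff {S : L →L[ℂ] L} (hS : IsArrow K K S) :
    S ∈ selfIntertwiners K V.dualOp ↔ S * V.op = V.op * S := by
  have hV := V.unitary_op
  have h1 : K.amp S * V.dualOp = flip K K * (S * star V.op) * flip K K := by
    rw [dualOp, ← mul_assoc, ← mul_assoc, ← flip_mul_arrow K hS]
    simp only [mul_assoc]
  have h2 : V.dualOp * K.amp S = flip K K * (star V.op * S) * flip K K := by
    rw [dualOp, mul_assoc, flip_mul_amp_arrow K hS]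
    simp only [mul_assoc]
  have h3 : K.amp S * V.dualOp = V.dualOp * K.amp S ↔ S * star V.op = star V.op * S := by
    rw [h1, h2]
    constructor
    · intro h
      have e : ∀ A, flip K K * (flip K K * A * flip K K) * flip K K = A := fun A => by
        calc _ = (flip K K * flip K K) * A * (flip K K * flip K K) := by simp only [mul_assoc]
          _ = A := by rw [HilbertIn.flip_flip, one_mul, mul_one]
      rw [← e (S * star V.op), h, e]
    · intro h
      rw [h]
  constructor
  · intro h
    have h' := h3.1 h.2
    calc S * V.op = V.op * (star V.op * S) * V.op := by
          rw [← mul_assoc, Unitary.mul_star_self_of_mem hV, one_mul]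
      _ = V.op * S := by
          rw [← h', mul_assoc, mul_assoc, Unitary.star_mul_self_of_mem hV, mul_one]
  · intro h
    refine ⟨hS, h3.2 ?_⟩
    calc S * star V.op = star V.op * (V.op * S) * star V.op := by
          rw [← mul_assoc, Unitary.star_mul_self_of_mem hV, one_mul]
      _ = star V.op * S := by
          rw [← h, mul_assoc, mul_assoc, Unitary.mul_star_self_of_mem hV, mul_one]

end MultiplicativeUnitary

/-! ### Arrows of corepresentations, and the arrows from $V$ to $V\times W$. -/

namespace Corep

theorem star_mul_op (W : Corep V) : star W.op * W.op = 1 :=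
  Unitary.star_mul_self_of_mem W.unitary_op

theorem op_mul_star (W : Corep V) : W.op * star W.op = 1 :=
  Unitary.mul_star_self_of_mem W.unitary_op

theorem ext_space_op {W W' : Corep V} (h : W.space = W'.space) (h' : W.op = W'.op) : W = W' := by
  cases W; cases W'; cases h; cases h'; rfl

/-- The corepresentation identity tested on `K` in the first factor: operators on `K` commuting
with `V` commute with every corepresentation. -/
theorem commute_op_of_commute (W : Corep V) {S : L →L[ℂ] L} (hS : IsArrow K K S)
    (h : S * V.op = V.op * S) : S * W.op = W.op * S := by
  -- The corepresentation identity solved for $W_{13}$. On the right, $S$ on the first factor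
  -- commutes with $V_{12}$ by assumption and with $W_{23}$ because the legs are disjoint.
  have h1 : leg13 K K W.space W.op = star V.op * K.amp W.op * V.op * star (K.amp W.op) := by
    have h2 := Unitary.mul_star_self_of_mem (K.amp_unitary W.unitary_op)
    calc leg13 K K W.space W.op
        = star V.op * (V.op * leg13 K K W.space W.op * K.amp W.op) * star (K.amp W.op) := by
          rw [← mul_assoc, ← mul_assoc, Unitary.star_mul_self_of_mem V.unitary_op, one_mul,
            mul_assoc, h2, mul_one]
      _ = _ := by rw [W.corep, ← mul_assoc]
  have h3 : S * star V.op = star V.op * S := by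
    have := ((MultiplicativeUnitary.mem_selfIntertwiners_dualOp_iff hS).2 h)
    have := (MultiplicativeUnitary.mem_selfIntertwiners_dualOp_iff hS.star).1
      (MultiplicativeUnitary.star_mem_selfIntertwiners V.dualOp_unitary this)
    simpa using (congrArg star this).symm
  have h4 : S * leg13 K K W.space W.op = leg13 K K W.space W.op * S := by
    rw [h1, ← amp_star]
    calc S * (star V.op * K.amp W.op * V.op * K.amp (star W.op))
        = (S * star V.op) * K.amp W.op * V.op * K.amp (star W.op) := by simp only [mul_assoc]
      _ = star V.op * (S * K.amp W.op) * V.op * K.amp (star W.op) := by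
          rw [h3]; simp only [mul_assoc]
      _ = star V.op * K.amp W.op * (S * V.op) * K.amp (star W.op) := by
          rw [hS.mul_amp]; simp only [mul_assoc]
      _ = star V.op * K.amp W.op * V.op * (S * K.amp (star W.op)) := by
          rw [h]; simp only [mul_assoc]
      _ = _ := by rw [hS.mul_amp]; simp only [mul_assoc]
  -- Flipping the first two factors turns $W_{13}$ into $W_{23}$ and $S$ on the first into $S$ on
  -- the second; the idle first factor is then dropped.
  have h5 : K.amp (S * W.op) = K.amp (W.op * S) := by
    have e : flip K K * leg13 K K W.space W.op * flip K K = K.amp W.op := by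
      rw [flip_mul_leg13 W.isArrow, mul_assoc, HilbertIn.flip_flip, mul_one]
    rw [amp_comp, amp_comp, ← e]
    calc K.amp S * (flip K K * leg13 K K W.space W.op * flip K K)
        = flip K K * (S * leg13 K K W.space W.op) * flip K K := by
          rw [← mul_assoc, ← mul_assoc, ← flip_mul_arrow K hS]; simp only [mul_assoc]
      _ = _ := by
          rw [h4, mul_assoc _ (flip K K) (K.amp S), flip_mul_amp_arrow K hS]
          simp only [mul_assoc]
  exact K.amp_injective h5

namespace IsIntertwiner

theorem comp {W W' W'' : Corep V} {S T : L →L[ℂ] L} (hS : IsIntertwiner W' W'' S)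
    (hT : IsIntertwiner W W' T) : IsIntertwiner W W'' (S * T) :=
  ⟨hS.1.comp hT.1, by
    rw [K.amp_comp, mul_assoc, hT.2, ← mul_assoc, hS.2, mul_assoc]⟩

theorem star {W W' : Corep V} {T : L →L[ℂ] L} (hT : IsIntertwiner W W' T) :
    IsIntertwiner W' W (star T) := by
  refine ⟨hT.1.star, ?_⟩
  have h : Star.star W'.op * K.amp T = K.amp T * Star.star W.op := by
    calc Star.star W'.op * K.amp T = Star.star W'.op * (K.amp T * W.op) * Star.star W.op := by
          rw [mul_assoc, mul_assoc, op_mul_star, mul_one]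
      _ = K.amp T * Star.star W.op := by
          rw [hT.2, ← mul_assoc, star_mul_op, one_mul]
  simpa [amp_star] using congrArg Star.star h

/-- `T × 1_Z` -/
theorem tensor_right {W W' : Corep V} {T : L →L[ℂ] L} (hT : IsIntertwiner W W' T) (Z : Corep V) :
    IsIntertwiner (W.tensor Z) (W'.tensor Z) T := by
  refine ⟨hT.1.tensor_right Z.space, ?_⟩
  change K.amp T * (W.op * leg13 K W.space Z.space Z.op) =
    W'.op * leg13 K W'.space Z.space Z.op * K.amp T
  rw [← mul_assoc, hT.2, mul_assoc, mul_assoc, leg13_naturality Z.isArrow hT.1]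

/-- `1_Z × T` -/
theorem tensor_left {W W' : Corep V} {T : L →L[ℂ] L} (hT : IsIntertwiner W W' T) (Z : Corep V) :
    IsIntertwiner (Z.tensor W) (Z.tensor W') (Z.space.amp T) := by
  refine ⟨hT.1.amp Z.space, ?_⟩
  change K.amp (Z.space.amp T) * (Z.op * leg13 K Z.space W.space W.op) =
    Z.op * leg13 K Z.space W'.space W'.op * K.amp (Z.space.amp T)
  rw [← mul_assoc, ← amp_tensor, ← Z.isArrow.mul_amp, mul_assoc, mul_assoc, amp_tensor]
  congr 1
  refine K.amp_op_ext Z.space fun φ hφ => ?_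
  rw [mul_assoc, leg13_mul_amp W.isArrow hφ, mul_assoc, ← K.amp_comp, Z.space.amp_mul _ hφ,
    K.amp_comp, ← mul_assoc, ← K.amp_comp, Z.space.amp_mul _ hφ, K.amp_comp, mul_assoc, hT.2,
    ← mul_assoc, ← mul_assoc, leg13_mul_amp W'.isArrow hφ]

/-- If `1_Z × T` is an arrow then so is `T`. -/
theorem of_tensor_left {W W' : Corep V} {T : L →L[ℂ] L} (hT : IsArrow W.space W'.space T)
    (Z : Corep V) (h : IsIntertwiner (Z.tensor W) (Z.tensor W') (Z.space.amp T)) :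
    IsIntertwiner W W' T := by
  refine ⟨hT, ?_⟩
  have h1 : K.amp (Z.space.amp T) * (Z.op * leg13 K Z.space W.space W.op) =
    Z.op * leg13 K Z.space W'.space W'.op * K.amp (Z.space.amp T) := h.2
  rw [← mul_assoc, ← amp_tensor, ← Z.isArrow.mul_amp, mul_assoc, mul_assoc, amp_tensor] at h1
  have h2 := congrArg (fun A => Star.star Z.op * A) h1
  simp only [← mul_assoc, star_mul_op, one_mul] at h2
  have h3 : ∀ φ ∈ Z.space.carrier, K.amp φ * (K.amp T * W.op) = K.amp φ * (W'.op * K.amp T) := by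
    intro φ hφ
    have h4 := congrArg (fun A => A * K.amp φ) h2
    rwa [mul_assoc, leg13_mul_amp W.isArrow hφ, mul_assoc, ← K.amp_comp, Z.space.amp_mul _ hφ,
      ← mul_assoc, ← K.amp_comp, Z.space.amp_mul _ hφ, K.amp_comp, ← mul_assoc,
      leg13_mul_amp W'.isArrow hφ, mul_assoc, mul_assoc] at h4
  rcases subsingleton_or_nontrivial L with hL | hL
  · exact ContinuousLinearMap.ext fun x => Subsingleton.elim _ _
  obtain ⟨ψ, hψ, χ, hχ, h5⟩ := Z.space.exists_star_mul_eq_one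
  have h6 := congrArg (fun A => K.amp (Star.star ψ) * A) (h3 χ hχ)
  rwa [← mul_assoc, ← mul_assoc (K.amp (Star.star ψ)), ← K.amp_comp, h5, K.amp_one, one_mul,
    one_mul] at h6

end IsIntertwiner

theorem tensor_assoc (W W' W'' : Corep V) :
    (W.tensor W').tensor W'' = W.tensor (W'.tensor W'') := by
  refine ext_space_op (HilbertIn.tensor_assoc _ _ _) ?_
  change W.op * leg13 K W.space W'.space W'.op *
      leg13 K (W.space.tensor W'.space) W''.space W''.op =
    W.op * leg13 K W.space (W'.space.tensor W''.space)
      (W'.op * leg13 K W'.space W''.space W''.op)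
  rw [mul_assoc]
  congr 1
  refine K.amp_op_ext W.space fun φ hφ => ?_
  have h1 : IsArrow (K.tensor (W'.space.tensor W''.space)) (K.tensor (W'.space.tensor W''.space))
      (W'.op * leg13 K W'.space W''.space W''.op) := (W'.tensor W'').isArrow
  rw [leg13_mul_amp h1 hφ]
  refine K.amp_op_ext W'.space fun φ' hφ' => ?_
  rw [mul_assoc, mul_assoc, ← K.amp_comp, leg13_mul_amp W''.isArrow (mul_mem_tensor _ _ hφ hφ'),
    K.amp_comp, ← mul_assoc, ← mul_assoc, leg13_mul_amp W'.isArrow hφ, mul_assoc, mul_assoc,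
    mul_assoc, mul_assoc, leg13_mul_amp W''.isArrow hφ']

/-- For `φ` in the space of `W`, the arrow `ψ ↦ W ψ φ` from `V` to `V × W`. -/
noncomputable def absorb (W : Corep V) (φ : L →L[ℂ] L) : L →L[ℂ] L := W.op * K.amp φ

/-- This is the identity $V_{12}W_{13}W_{23}=W_{23}V_{12}$ evaluated at $\varphi$ in the last
factor. -/
theorem isIntertwiner_absorb (W : Corep V) {φ : L →L[ℂ] L} (hφ : φ ∈ W.space.carrier) :
    IsIntertwiner (regular V) ((regular V).tensor W) (W.absorb φ) := by
  refine ⟨W.isArrow.comp (isArrow_amp_of_mem K hφ), ?_⟩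
  change K.amp (W.op * K.amp φ) * V.op = V.op * leg13 K K W.space W.op * K.amp (W.op * K.amp φ)
  rw [K.amp_comp, ← mul_assoc, W.corep, mul_assoc, mul_assoc, ← amp_tensor, V.isArrow.mul_amp]

/-- The vectors $\psi\varphi$ are total in $KH$ and $W$ is invertible, so equations between
operators on $KH$ may be tested on absorbing arrows. -/
theorem absorb_ext (W : Corep V) {S T : L →L[ℂ] L}
    (h : ∀ φ ∈ W.space.carrier, S * W.absorb φ = T * W.absorb φ) : S = T := by
  have h1 : S * W.op = T * W.op :=
    K.amp_op_ext W.space fun φ hφ => by rw [mul_assoc, mul_assoc]; exact h φ hφ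
  calc S = S * W.op * star W.op := by rw [mul_assoc, op_mul_star, mul_one]
    _ = T := by rw [h1, mul_assoc, op_mul_star, mul_one]

theorem amp_absorb_ext (W : Corep V) {S T : L →L[ℂ] L}
    (h : ∀ φ ∈ W.space.carrier, S * K.amp (W.absorb φ) = T * K.amp (W.absorb φ)) : S = T :=
  K.op_ext fun ψ hψ => W.absorb_ext fun φ hφ => by
    rw [mul_assoc, ← K.amp_mul _ hψ, ← mul_assoc, h φ hφ, mul_assoc, K.amp_mul _ hψ, mul_assoc]

/-- The leg $W'_{13}$ slides past $\varphi$ in the middle factor. This multiplicativity is the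
source of the tensor formula for the constructed components. -/
theorem absorb_tensor (W W' : Corep V) {φ φ' : L →L[ℂ] L} (hφ : φ ∈ W.space.carrier) :
    (W.tensor W').absorb (φ * φ') = W.absorb φ * W'.absorb φ' := by
  change W.op * leg13 K W.space W'.space W'.op * K.amp (φ * φ') = _
  rw [K.amp_comp, mul_assoc, ← mul_assoc (leg13 _ _ _ _), leg13_mul_amp W'.isArrow hφ, absorb,
    absorb]
  simp only [mul_assoc]

/-- Operators acting to the right of `H` slide through the absorbing arrows. -/
theorem amp_amp_mul_absorb (W : Corep V) {φ : L →L[ℂ] L} (hφ : φ ∈ W.space.carrier)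
    (S : L →L[ℂ] L) : K.amp (W.space.amp S) * W.absorb φ = W.absorb φ * K.amp S := by
  rw [absorb, ← mul_assoc, ← amp_tensor, ← W.isArrow.mul_amp, mul_assoc, amp_tensor,
    ← K.amp_comp, W.space.amp_mul _ hφ, K.amp_comp, mul_assoc]

/-- An operator on `A K` commuting with `1_A × V` commutes with `1_A × W`. -/
theorem commute_amp_op_of_commute (W : Corep V) {A : HilbertIn M} {B : L →L[ℂ] L}
    (hB : IsArrow (A.tensor K) (A.tensor K) B) (h : B * A.amp V.op = A.amp V.op * B) :
    B * A.amp W.op = A.amp W.op * B := by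
  refine A.op_ext fun ψ hψ => A.star_mul_ext fun χ hχ => ?_
  -- The slices of $B$ over $A$ are operators on $K$ commuting with $V$, so the scalar-coefficient
  -- case applies to each of them.
  have hb : IsArrow K K (star χ * B * ψ) :=
    ((isArrow_of_mem K hχ).star.comp hB).comp (isArrow_of_mem K hψ)
  have hslice : ∀ R, star χ * (B * A.amp R * ψ) = star χ * B * ψ * R := fun R => by
    rw [mul_assoc B, A.amp_mul _ hψ]; simp only [mul_assoc]
  have hslice' : ∀ R, star χ * (A.amp R * B * ψ) = R * (star χ * B * ψ) := fun R => by
    rw [← mul_assoc, ← mul_assoc, A.star_mul_amp _ hχ]; simp only [mul_assoc]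
  rw [hslice, hslice']
  refine W.commute_op_of_commute hb ?_
  rw [← hslice, ← hslice', h]

end Corep

/-! ### Reconstruction of the components from $e=\varepsilon_V$. -/

/-- The properties of the component at `V` of a braided symmetry. -/
structure IsRegularBraiding (V : MultiplicativeUnitary K) (e : L →L[ℂ] L) : Prop where
  unitary_op : e ∈ unitary (L →L[ℂ] L)
  isIntertwiner : Corep.IsIntertwiner ((Corep.regular V).tensor (Corep.regular V))
    ((Corep.regular V).tensor (Corep.regular V)) e
  naturality : ∀ S, Corep.IsIntertwiner (Corep.regular V) (Corep.regular V) S →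
    e * S = K.amp S * e
  absorb : ∀ φ ∈ K.carrier, K.amp e * (Corep.regular V).absorb φ =
    star e * K.amp ((Corep.regular V).absorb φ) * e

/-- `Y` satisfies the identity which naturality with respect to the arrows from `V` to `V × W`
imposes on the component at `W` of a braided symmetry with component `e` at `V`. -/
def IsComponent (e : L →L[ℂ] L) (W : Corep V) (Y : L →L[ℂ] L) : Prop :=
  ∀ φ ∈ W.space.carrier, K.amp Y * W.absorb φ = star e * K.amp (W.absorb φ) * e

/-- The operator `1_K × ε_W` in terms of `e = ε_V`. -/
noncomputable def ampComponent (e : L →L[ℂ] L) (W : Corep V) : L →L[ℂ] L :=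
  star e * K.amp W.op * e * K.amp (flip W.space K) * star W.op

theorem IsComponent.unique {e : L →L[ℂ] L} {W : Corep V} {Y Y' : L →L[ℂ] L} (hY : IsComponent e W Y)
    (hY' : IsComponent e W Y') : Y = Y' :=
  K.amp_injective (W.absorb_ext fun φ hφ => by rw [hY φ hφ, hY' φ hφ])

namespace IsRegularBraiding

variable {e : L →L[ℂ] L}

theorem star_mul_self (he : IsRegularBraiding V e) : star e * e = 1 :=
  Unitary.star_mul_self_of_mem he.unitary_op

theorem mul_star_self (he : IsRegularBraiding V e) : e * star e = 1 :=
  Unitary.mul_star_self_of_mem he.unitary_op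

theorem mul_amp_amp (he : IsRegularBraiding V e) (S : L →L[ℂ] L) :
    e * K.amp (K.amp S) = K.amp (K.amp S) * e := by
  rw [← amp_tensor]; exact he.isIntertwiner.1.mul_amp S

theorem star_mul_amp_amp (he : IsRegularBraiding V e) (S : L →L[ℂ] L) :
    star e * K.amp (K.amp S) = K.amp (K.amp S) * star e := by
  rw [← amp_tensor]; exact he.isIntertwiner.1.star.mul_amp S

/-- The factor $W^*$ undoes the absorption and the flip carries $\varphi$ to the last position,
where it passes through $e$. -/
theorem ampComponent_mul_absorb (he : IsRegularBraiding V e) (W : Corep V) {φ : L →L[ℂ] L} (hφ :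
    φ ∈ W.space.carrier) :
    ampComponent e W * W.absorb φ = star e * K.amp (W.absorb φ) * e := by
  have h : star W.op * W.absorb φ = K.amp φ := by
    rw [Corep.absorb, ← mul_assoc, W.star_mul_op, one_mul]
  rw [ampComponent, mul_assoc, h, mul_assoc, ← K.amp_comp, flip_mul _ _ hφ, mul_assoc,
    he.mul_amp_amp, Corep.absorb, K.amp_comp]
  simp only [mul_assoc]

/-- Extends the defining identity from absorbing arrows to all arrows from $V$ to $V\times W$. This
is needed because $S$ composed with an absorbing arrow, $S\in(V,V)$, need not be absorbing. -/
theorem ampComponent_mul (he : IsRegularBraiding V e) (W : Corep V) {T : L →L[ℂ] L}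
    (hT : Corep.IsIntertwiner (Corep.regular V) ((Corep.regular V).tensor W) T) :
    ampComponent e W * T = star e * K.amp T * e := by
  -- Tested against $\varphi^*$ in the last factor, $T$ becomes $a_\varphi^*T$ with $a_\varphi$ the
  -- absorbing arrow. This lies in $(V,V)$, where naturality of $e$ is available.
  have key : e * (K.amp (flip W.space K) * (star W.op * T)) = K.amp (star W.op * T) * e := by
    refine (K.tensor K).amp_star_mul_ext W.space fun φ hφ => ?_
    have h1 := he.naturality _ ((W.isIntertwiner_absorb hφ).star.comp hT)
    rw [Corep.absorb, star_mul, ← amp_star, mul_assoc] at h1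
    rw [amp_tensor, ← mul_assoc, ← he.mul_amp_amp, mul_assoc, ← mul_assoc (K.amp (K.amp _)),
      ← K.amp_comp, amp_star_mul_flip _ _ hφ, h1, ← mul_assoc (K.amp (K.amp _)), ← K.amp_comp]
  rw [ampComponent, mul_assoc, mul_assoc _ e, mul_assoc, mul_assoc (star e), mul_assoc e, key,
    ← mul_assoc (K.amp W.op), ← K.amp_comp, ← mul_assoc W.op, W.op_mul_star, one_mul, mul_assoc]

theorem ampComponent_commute_regular (he : IsRegularBraiding V e) (W : Corep V) {S : L →L[ℂ] L}
    (hS : S ∈ MultiplicativeUnitary.selfIntertwiners K V.op) :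
    ampComponent e W * S = S * ampComponent e W := by
  have hS' : Corep.IsIntertwiner (Corep.regular V) (Corep.regular V) S := hS
  have h1 : S * star e = star e * K.amp S := by
    calc S * star e = star e * (e * S) * star e := by
          rw [← mul_assoc, he.star_mul_self, one_mul]
      _ = star e * K.amp S := by
          rw [he.naturality S hS', mul_assoc, mul_assoc, he.mul_star_self, mul_one]
  refine W.absorb_ext fun φ hφ => ?_
  rw [mul_assoc, he.ampComponent_mul W ((hS'.tensor_right W).comp (W.isIntertwiner_absorb hφ)),
    mul_assoc S, he.ampComponent_mul_absorb W hφ, ← mul_assoc S, ← mul_assoc S, h1, K.amp_comp]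
  simp only [mul_assoc]

theorem ampComponent_regular (he : IsRegularBraiding V e) :
    ampComponent e (Corep.regular V) = K.amp e :=
  (Corep.regular V).absorb_ext fun φ hφ => by
    rw [he.ampComponent_mul_absorb _ hφ]; exact (he.absorb φ hφ).symm

/-- Here $S$ commutes with each factor outside $e^*(1_K\times W)e$; commutation with that product is
transported from $V$ to $W$ by passing to $eSe^*$. -/
theorem ampComponent_commute_dual (he : IsRegularBraiding V e) (W : Corep V) {S : L →L[ℂ] L}
    (hS : S ∈ MultiplicativeUnitary.selfIntertwiners K V.dualOp) :
    ampComponent e W * S = S * ampComponent e W := by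
  have hSV := (MultiplicativeUnitary.mem_selfIntertwiners_dualOp_iff hS.1).1 hS
  have hB : IsArrow (K.tensor K) (K.tensor K) (e * S * star e) :=
    (he.isIntertwiner.1.comp (hS.1.tensor_right K)).comp he.isIntertwiner.1.star
  -- The formula for the component at $V$, rearranged so that $S$ visibly commutes with the right
  -- side: it commutes with $V$, and the other factors do not touch the first leg.
  have hD : star e * K.amp V.op * e = K.amp e * V.op * K.amp (flip K K) := by
    have h : star e * K.amp V.op * e * K.amp (flip K K) * star V.op = K.amp e :=
      he.ampComponent_regular
    rw [← h, mul_assoc _ (star V.op), Unitary.star_mul_self_of_mem V.unitary_op, mul_one,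
      mul_assoc _ (K.amp (flip K K)), ← K.amp_comp, HilbertIn.flip_flip, K.amp_one, mul_one]
  have hSD : S * (star e * K.amp V.op * e) = star e * K.amp V.op * e * S := by
    rw [hD, mul_assoc _ _ S, ← hS.1.mul_amp, ← mul_assoc, ← mul_assoc, hS.1.mul_amp,
      mul_assoc _ S, hSV]
    simp only [mul_assoc]
  have hcomm : ∀ Q, S * (star e * Q * e) = star e * Q * e * S ↔
      e * S * star e * Q = Q * (e * S * star e) := by
    intro Q
    constructor
    · intro h
      calc e * S * star e * Q = e * (S * (star e * Q * e)) * star e := by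
            simp only [mul_assoc, he.mul_star_self, mul_one]
        _ = (e * star e) * Q * (e * S * star e) := by rw [h]; simp only [mul_assoc]
        _ = _ := by rw [he.mul_star_self, one_mul]
    · intro h
      calc S * (star e * Q * e) = star e * (e * S * star e * Q) * e := by
            simp only [← mul_assoc, he.star_mul_self, one_mul]
        _ = star e * Q * e * S * (star e * e) := by rw [h]; simp only [mul_assoc]
        _ = _ := by rw [he.star_mul_self, mul_one]
  have hW := (hcomm _).2 (W.commute_amp_op_of_commute hB ((hcomm _).1 hSD))
  have hSW' : S * star W.op = star W.op * S := by
    calc S * star W.op = star W.op * (W.op * S) * star W.op := by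
          rw [← mul_assoc, W.star_mul_op, one_mul]
      _ = _ := by
          rw [← W.commute_op_of_commute hS.1 hSV, mul_assoc, mul_assoc, W.op_mul_star, mul_one]
  rw [ampComponent, mul_assoc _ _ S, ← hSW', ← mul_assoc, mul_assoc _ _ S, ← hS.1.mul_amp,
    ← mul_assoc, ← hW]
  simp only [mul_assoc]

theorem isArrow_ampComponent (he : IsRegularBraiding V e) (W : Corep V) :
    IsArrow (K.tensor (W.space.tensor K)) (K.tensor (K.tensor W.space)) (ampComponent e W) := by
  have h1 : IsArrow (K.tensor (W.space.tensor K)) (K.tensor (W.space.tensor K)) (star W.op) := by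
    rw [← HilbertIn.tensor_assoc]; exact W.isArrow.star.tensor_right K
  have h2 : IsArrow (K.tensor (K.tensor W.space)) (K.tensor (K.tensor W.space)) e := by
    rw [← HilbertIn.tensor_assoc]; exact he.isIntertwiner.1.tensor_right W.space
  exact (((h2.star.comp (W.isArrow.amp K)).comp h2).comp ((isArrow_flip W.space K).amp K)).comp h1

theorem ampComponent_unitary (he : IsRegularBraiding V e) (W : Corep V) :
    ampComponent e W ∈ unitary (L →L[ℂ] L) :=
  mul_mem (mul_mem (mul_mem (mul_mem (Unitary.star_mem he.unitary_op) (K.amp_unitary W.unitary_op))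
    he.unitary_op) (K.amp_unitary (flip_unitary _ _))) (Unitary.star_mem W.unitary_op)

theorem isComponent_iff (he : IsRegularBraiding V e) {W : Corep V} {Y : L →L[ℂ] L} :
    IsComponent e W Y ↔ K.amp Y = ampComponent e W := by
  constructor
  · intro h
    exact W.absorb_ext fun φ hφ => by rw [h φ hφ, he.ampComponent_mul_absorb W hφ]
  · intro h φ hφ
    rw [h, he.ampComponent_mul_absorb W hφ]

/-- The one place where irreducibility enters. -/
theorem exists_isComponent (he : IsRegularBraiding V e)
    (hirr : MultiplicativeUnitary.ActsIrreducibly K (V.generatedAlgebra : Set (L →L[ℂ] L)))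
    (W : Corep V) :
    ∃ Y, IsArrow (W.space.tensor K) (K.tensor W.space) Y ∧ IsComponent e W Y := by
  obtain ⟨Y, hY, hYX⟩ := exists_amp_eq_of_commute (actsIrreducibly_of_adjoin hirr)
    (by rintro S (hS | hS) <;> exact hS.1)
    (by
      rintro S (hS | hS)
      · exact Or.inl (MultiplicativeUnitary.star_mem_selfIntertwiners V.unitary_op hS)
      · exact Or.inr (MultiplicativeUnitary.star_mem_selfIntertwiners V.dualOp_unitary hS))
    (he.isArrow_ampComponent W)
    (by
      rintro S (hS | hS)
      · exact he.ampComponent_commute_regular W hS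
      · exact he.ampComponent_commute_dual W hS)
  exact ⟨Y, hY, he.isComponent_iff.2 hYX⟩

theorem unitary_of_isComponent (he : IsRegularBraiding V e) {W : Corep V} {Y : L →L[ℂ] L} (hY :
    IsComponent e W Y) :
    Y ∈ unitary (L →L[ℂ] L) := by
  have h := he.ampComponent_unitary W
  rw [← he.isComponent_iff.1 hY, Unitary.mem_iff, ← amp_star, ← amp_comp, ← amp_comp,
    ← K.amp_one] at h
  exact ⟨K.amp_injective h.1, K.amp_injective h.2⟩

/-- After tensoring with $1_V$ on the left, the claim may be tested on absorbing arrows; there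
$(1_K\times Y)a_\varphi$ equals $e^*(1_K\times a_\varphi)e$, a composite of arrows. -/
theorem isIntertwiner_of_isComponent (he : IsRegularBraiding V e) {W : Corep V} {Y : L →L[ℂ] L}
    (hYa : IsArrow (W.space.tensor K) (K.tensor W.space) Y) (hY : IsComponent e W Y) :
    Corep.IsIntertwiner (W.tensor (Corep.regular V)) ((Corep.regular V).tensor W) Y := by
  refine Corep.IsIntertwiner.of_tensor_left hYa (Corep.regular V) ⟨hYa.amp K, ?_⟩
  refine W.amp_absorb_ext fun φ hφ => ?_
  have h1 := (W.isIntertwiner_absorb hφ).tensor_right (Corep.regular V)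
  have h2 := (W.isIntertwiner_absorb hφ).tensor_left (Corep.regular V)
  have h3 := he.isIntertwiner.star.tensor_right W
  rw [Corep.tensor_assoc] at h1 h3
  have h4 := ((h3.comp h2).comp he.isIntertwiner).2
  change K.amp (star e * K.amp (W.absorb φ) * e) * _ =
    _ * K.amp (star e * K.amp (W.absorb φ) * e) at h4
  rw [← hY φ hφ, K.amp_comp] at h4
  change K.amp (K.amp Y) * _ * _ = _ * K.amp (K.amp Y) * _
  rw [mul_assoc, ← h1.2, ← mul_assoc, h4, mul_assoc]

theorem naturality_of_isComponent (he : IsRegularBraiding V e) {W W' : Corep V} {Y Y' S : L →L[ℂ] L}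
    (hY : IsComponent e W Y) (hY' : IsComponent e W' Y') (hS : Corep.IsIntertwiner W W' S) :
    Y' * S = K.amp S * Y := by
  refine K.amp_injective (W.absorb_ext fun φ hφ => ?_)
  have h : K.amp S * W.absorb φ = W'.absorb (S * φ) := by
    rw [Corep.absorb, Corep.absorb, K.amp_comp, ← mul_assoc, hS.2, mul_assoc]
  rw [K.amp_comp, K.amp_comp, mul_assoc, h, hY' _ (hS.1.2 φ hφ), mul_assoc (K.amp (K.amp S)),
    hY φ hφ,
    ← h, K.amp_comp, ← mul_assoc, ← mul_assoc, ← mul_assoc, he.star_mul_amp_amp]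

/-- Both sides are tested on a product of two absorbing arrows; inserting $ee^*=1$ between them
splits the identity for $W\times W'$ into those for $W$ and $W'$. -/
theorem tensor_of_isComponent (he : IsRegularBraiding V e) {W W' : Corep V} {Y Y' Z : L →L[ℂ] L}
    (hY : IsComponent e W Y) (hY' : IsComponent e W' Y') (hZ : IsComponent e (W.tensor W') Z) :
    Z = Y * W.space.amp Y' := by
  refine K.amp_injective (W.absorb_ext fun φ hφ => W'.absorb_ext fun φ' hφ' => ?_)
  have h1 := hZ (φ * φ') (mul_mem_tensor _ _ hφ hφ')
  rw [W.absorb_tensor W' hφ] at h1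
  rw [mul_assoc, h1, K.amp_comp Y, mul_assoc (K.amp Y), W.amp_amp_mul_absorb hφ,
    mul_assoc _ _ (W'.absorb φ'), mul_assoc (W.absorb φ), hY' φ' hφ', ← mul_assoc (K.amp Y),
    hY φ hφ, K.amp_comp]
  calc star e * (K.amp (W.absorb φ) * K.amp (W'.absorb φ')) * e
      = star e * K.amp (W.absorb φ) * 1 * K.amp (W'.absorb φ') * e := by
        simp only [mul_assoc, one_mul]
    _ = _ := by rw [← he.mul_star_self]; simp only [mul_assoc]

end IsRegularBraiding

/-! ### The arrows from which $\eta_W$ is composed. -/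

namespace Corep

theorem isIntertwiner_op (W : Corep V) :
    IsIntertwiner ((regular V).tensor W.forget) ((regular V).tensor W) W.op := by
  refine ⟨W.isArrow, ?_⟩
  change K.amp W.op * (V.op * leg13 K K W.space 1) = V.op * leg13 K K W.space W.op * K.amp W.op
  rw [leg13_one, mul_one, W.corep]

theorem isIntertwiner_flip (W : Corep V) :
    IsIntertwiner ((regular V).tensor W.forget) (W.forget.tensor (regular V))
      (flip K W.space) := by
  refine ⟨isArrow_flip K W.space, ?_⟩
  change K.amp (flip K W.space) * (V.op * leg13 K K W.space 1) =
    1 * leg13 K W.space K V.op * K.amp (flip K W.space)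
  rw [leg13_one, mul_one, one_mul, leg13, mul_assoc _ (K.amp (flip W.space K)), ← K.amp_comp,
    HilbertIn.flip_flip, K.amp_one, mul_one]

theorem star_op_mul_amp {W W' : Corep V} {S : L →L[ℂ] L} (hS : IsIntertwiner W W' S) :
    star W'.op * K.amp S = K.amp S * star W.op := by
  have h := congrArg star hS.star.2
  simpa [amp_star] using h

end Corep

/-! ### Braided symmetries and their component at $V$. -/

namespace BraidedSymmetry

variable {T : FullTensorSubcategory V}

/-- Naturality along the absorbing arrow, combined with $\varepsilon_{V\times
W}=\varepsilon_V(1_K\times\varepsilon_W)$. -/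
theorem isComponent (ε : BraidedSymmetry T) (hV : Corep.regular V ∈ T.obj) (W : Corep V)
    (hW : W ∈ T.obj) : IsComponent (ε.app _ hV) W (ε.app W hW) := by
  intro φ hφ
  have h := ε.naturality _ hV _ (T.tensor_mem _ hV W hW) _ (W.isIntertwiner_absorb hφ)
  rw [ε.app_tensor _ hV W hW, mul_assoc] at h
  rw [mul_assoc, ← h, ← mul_assoc, Unitary.star_mul_self_of_mem (ε.unitary_app _ hV), one_mul]
  rfl

theorem isRegularBraiding (ε : BraidedSymmetry T) (hV : Corep.regular V ∈ T.obj) :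
    IsRegularBraiding V (ε.app _ hV) where
  unitary_op := ε.unitary_app _ hV
  isIntertwiner := ε.isIntertwiner _ hV
  naturality := fun S hS => ε.naturality _ hV _ hV S hS
  absorb := ε.isComponent hV _ hV

theorem ext_of_app_regular {ε ε' : BraidedSymmetry T} (hV : Corep.regular V ∈ T.obj)
    (h : ε.app _ hV = ε'.app _ hV) : ε = ε' := by
  refine BraidedSymmetry.ext (funext fun W => funext fun hW => ?_)
  exact (ε.isComponent hV W hW).unique (h ▸ ε'.isComponent hV W hW)

/-- The braided symmetry on `C(V)` with a given component at the regular corepresentation. -/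
theorem exists_app_regular_eq {e : L →L[ℂ] L} (he : IsRegularBraiding V e)
    (hirr : MultiplicativeUnitary.ActsIrreducibly K (V.generatedAlgebra : Set (L →L[ℂ] L))) :
    ∃ ε : BraidedSymmetry (fullCategory V), ∀ W, IsComponent e W (ε.app W trivial) := by
  choose Y hYa hY using he.exists_isComponent hirr
  exact ⟨{
    app := fun W _ => Y W
    isIntertwiner := fun W _ => he.isIntertwiner_of_isComponent (hYa W) (hY W)
    unitary_app := fun W _ => he.unitary_of_isComponent (hY W)
    naturality := fun W _ W' _ S hS => he.naturality_of_isComponent (hY W) (hY W') hS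
    app_tensor := fun W _ W' _ => he.tensor_of_isComponent (hY W) (hY W') (hY (W.tensor W')) }, hY⟩

/-! ### Standard braided symmetries. -/

theorem isLeftRegularObject_xi (T : FullTensorSubcategory V) : IsLeftRegularObject T (xi T) where
  isIntertwiner := fun W _ => W.isIntertwiner_op.star
  unitary_app := fun W _ => Unitary.star_mem W.unitary_op
  naturality := fun W _ W' _ S hS => Corep.star_op_mul_amp hS
  app_tensor := fun W _ W' _ => by
    change star (W.op * leg13 K W.space W'.space W'.op) =
      leg13 K W.space W'.space (star W'.op) * star W.op
    rw [star_mul, leg13, leg13, star_mul, star_mul, ← amp_star, ← amp_star, flip_star, flip_star,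
      ← mul_assoc]

theorem eta_eq (ε : BraidedSymmetry T) (W : Corep V) (hW : W ∈ T.obj) :
    ε.eta W hW = flip K W.space * star W.op * ε.app W hW := by
  rw [eta, flip_star, xi]

theorem app_eq (ε : BraidedSymmetry T) (W : Corep V) (hW : W ∈ T.obj) :
    ε.app W hW = W.op * flip W.space K * ε.eta W hW := by
  rw [eta_eq, mul_assoc, ← mul_assoc (flip W.space K), ← mul_assoc (flip W.space K),
    HilbertIn.flip_flip, one_mul, ← mul_assoc, W.op_mul_star, one_mul]

theorem isIntertwiner_eta (ε : BraidedSymmetry T) (W : Corep V) (hW : W ∈ T.obj) :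
    Corep.IsIntertwiner (W.tensor (Corep.regular V)) (W.forget.tensor (Corep.regular V))
      (ε.eta W hW) := by
  rw [eta_eq]
  exact (W.isIntertwiner_flip.comp W.isIntertwiner_op.star).comp (ε.isIntertwiner W hW)

theorem eta_unitary (ε : BraidedSymmetry T) (W : Corep V) (hW : W ∈ T.obj) :
    ε.eta W hW ∈ unitary (L →L[ℂ] L) := by
  rw [eta_eq]
  exact mul_mem (mul_mem (flip_unitary _ _) (Unitary.star_mem W.unitary_op)) (ε.unitary_app W hW)

theorem eta_naturality (ε : BraidedSymmetry T) {W W' : Corep V} (hW : W ∈ T.obj)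
    (hW' : W' ∈ T.obj) {S : L →L[ℂ] L} (hS : Corep.IsIntertwiner W W' S) :
    ε.eta W' hW' * S = S * ε.eta W hW := by
  rw [eta_eq, eta_eq, mul_assoc, ε.naturality W hW W' hW' S hS, ← mul_assoc,
    mul_assoc _ _ (K.amp S),
    Corep.star_op_mul_amp hS, ← mul_assoc, flip_mul_amp_arrow K hS.1]
  simp only [mul_assoc]

/-- After substituting $\varepsilon=W\vartheta\eta$ for both components, the only obstruction is
moving $\eta_W$ past $1\times W'$. Once that is done, $W'$ cancels against the adjoint of $W'_{13}$.
-/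
theorem eta_tensor (ε : BraidedSymmetry T) {W W' : Corep V} (hW : W ∈ T.obj) (hW' : W' ∈ T.obj)
    (h : ε.eta W hW * W.space.amp W'.op = W.space.amp W'.op * ε.eta W hW) :
    ε.eta (W.tensor W') (T.tensor_mem W hW W' hW') =
      leg13 W.space W'.space K (ε.eta W hW) * W.space.amp (ε.eta W' hW') := by
  have h1 : star (leg13 K W.space W'.space W'.op) * (flip W.space K * W.space.amp W'.op) =
      flip W.space K := by
    have h2 : flip W.space K * W.space.amp W'.op =
        leg13 K W.space W'.space W'.op * flip W.space K := by
      calc flip W.space K * W.space.amp W'.op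
          = flip W.space K * (W.space.amp W'.op * flip K W.space) * flip W.space K := by
            rw [mul_assoc, mul_assoc, HilbertIn.flip_flip, mul_one]
        _ = _ := by
            rw [← flip_mul_leg13 W'.isArrow, ← mul_assoc (flip W.space K), HilbertIn.flip_flip,
              one_mul]
    rw [h2, ← mul_assoc, Unitary.star_mul_self_of_mem (leg13_unitary W'.unitary_op), one_mul]
  have h3 : flip K (W.space.tensor W'.space) * flip W.space K =
      W.space.amp (flip K W'.space) := by
    rw [flip_tensor_right, mul_assoc, HilbertIn.flip_flip, mul_one]
  rw [eta_eq, ε.app_tensor W hW W' hW', ε.app_eq W hW, ε.app_eq W' hW', W.space.amp_comp,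
    W.space.amp_comp]
  change flip K (W.space.tensor W'.space) * star (W.op * leg13 K W.space W'.space W'.op) * _ = _
  rw [star_mul]
  calc _ = flip K (W.space.tensor W'.space) * star (leg13 K W.space W'.space W'.op) *
        (star W.op * W.op) * flip W.space K * (ε.eta W hW * W.space.amp W'.op) *
        W.space.amp (flip W'.space K) * W.space.amp (ε.eta W' hW') := by simp only [mul_assoc]
    _ = flip K (W.space.tensor W'.space) * (star (leg13 K W.space W'.space W'.op) *
        (flip W.space K * W.space.amp W'.op)) * ε.eta W hW *
        W.space.amp (flip W'.space K) * W.space.amp (ε.eta W' hW') := by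
      rw [h, W.star_mul_op, mul_one]; simp only [mul_assoc]
    _ = _ := by rw [h1, h3, leg13]

/-- If `η_V` commutes with `1_K × V`, then `η_W` commutes with `1_H × W'` for all `W`, `W'`. -/
theorem eta_commute (ε : BraidedSymmetry T) (hV : Corep.regular V ∈ T.obj)
    (h : ε.eta _ hV * K.amp V.op = K.amp V.op * ε.eta _ hV) (W : Corep V) (hW : W ∈ T.obj)
    (W' : Corep V) :
    ε.eta W hW * W.space.amp W'.op = W.space.amp W'.op * ε.eta W hW := by
  -- It suffices to treat $W'=V$.
  refine W'.commute_amp_op_of_commute (ε.isIntertwiner_eta W hW).1 ?_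
  have he := ε.isRegularBraiding hV
  set e := ε.app _ hV with hedef
  set η := ε.eta _ hV with hη
  have hηa : IsArrow (K.tensor K) (K.tensor K) η := (ε.isIntertwiner_eta _ hV).1
  have hηu : η ∈ unitary (L →L[ℂ] L) := ε.eta_unitary _ hV
  have heη : e = V.op * flip K K * η := ε.app_eq _ hV
  have hηW : η * K.amp W.op = K.amp W.op * η := W.commute_amp_op_of_commute hηa h
  set l := leg13 K W.space K V.op with hl
  have hleg : leg13 K K W.space W.op = flip K K * K.amp W.op * flip K K := leg13_eq W.isArrow
  -- `1_K × W` conjugated by `e`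
  have hZ : K.amp (star W.op) * (star e * K.amp W.op * e) =
      star η * leg13 K K W.space W.op * η := by
    have h1 : star V.op * K.amp W.op * V.op = leg13 K K W.space W.op * K.amp W.op := by
      rw [mul_assoc, ← W.corep, mul_assoc, ← mul_assoc,
        Unitary.star_mul_self_of_mem V.unitary_op, one_mul]
    have h2 : star η * K.amp W.op = K.amp W.op * star η :=
      (mul_star_comm_of_mul_comm hηu hηW.symm).symm
    calc K.amp (star W.op) * (star e * K.amp W.op * e)
        = K.amp (star W.op) * (star η * flip K K * (star V.op * K.amp W.op * V.op) *
            flip K K * η) := by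
          rw [heη, star_mul, star_mul, flip_star]; simp only [mul_assoc]
      _ = K.amp (star W.op) * (star η * ((flip K K * flip K K) * K.amp W.op * flip K K *
            K.amp W.op * flip K K) * η) := by
          rw [h1, hleg]; simp only [mul_assoc]
      _ = K.amp (star W.op) * (star η * K.amp W.op) * leg13 K K W.space W.op * η := by
          rw [HilbertIn.flip_flip, one_mul, hleg]; simp only [mul_assoc]
      _ = _ := by
          rw [h2, ← mul_assoc, ← K.amp_comp, W.star_mul_op, K.amp_one, one_mul]
  -- `K.amp l` is $V_{24}$ on $KKHK$: it is $1_K\times V$ with an idle factor $H$ inserted, so it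
  -- too commutes with $\eta$.
  have hηl : η * K.amp l = K.amp l * η := by
    refine (K.tensor K).amp_op_ext W.space fun φ hφ => ?_
    have h1 : K.amp l * K.amp (K.amp φ) = K.amp (K.amp φ) * K.amp V.op := by
      rw [← K.amp_comp, leg13_mul_amp V.isArrow hφ, K.amp_comp]
    have h2 : η * K.amp (K.amp φ) = K.amp (K.amp φ) * η := by
      rw [← amp_tensor, hηa.mul_amp]
    rw [amp_tensor, mul_assoc, h1, ← mul_assoc, h2, mul_assoc, h, mul_assoc (K.amp l), h2,
      ← mul_assoc (K.amp l), h1, mul_assoc]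
  have hηl' : star η * K.amp l = K.amp l * star η :=
    (mul_star_comm_of_mul_comm hηu hηl.symm).symm
  have hfl : flip K W.space * l = W.space.amp V.op * flip K W.space := flip_mul_leg13 V.isArrow
  have hlf : l * flip W.space K = flip W.space K * W.space.amp V.op := by
    calc l * flip W.space K = flip W.space K * (flip K W.space * l) * flip W.space K := by
          rw [← mul_assoc, HilbertIn.flip_flip, one_mul]
      _ = _ := by
          rw [hfl, mul_assoc, mul_assoc, HilbertIn.flip_flip, mul_one]
  -- $W_{13}$ and $V_{24}$ act on disjoint legs.
  have hlegl : leg13 K K W.space W.op * K.amp l = K.amp l * leg13 K K W.space W.op := by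
    have h1 : W.op * K.amp (W.space.amp V.op) = K.amp (W.space.amp V.op) * W.op := by
      rw [← amp_tensor, W.isArrow.mul_amp]
    rw [leg13, mul_assoc, ← K.amp_comp, hfl, K.amp_comp, mul_assoc, ← mul_assoc W.op, h1,
      ← mul_assoc, ← mul_assoc, ← K.amp_comp, ← hlf, K.amp_comp]
    simp only [mul_assoc]
  have hZl : star η * leg13 K K W.space W.op * η * K.amp l =
      K.amp l * (star η * leg13 K K W.space W.op * η) := by
    rw [mul_assoc, hηl, ← mul_assoc, mul_assoc (star η), hlegl, ← mul_assoc, hηl']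
    simp only [mul_assoc]
  -- On absorbing arrows $1_K\times\eta_W$ becomes $\eta^*W_{13}\eta$ followed by a flip, so
  -- commutation with $V_{24}$ carries over to $\eta_W$.
  have heta : ∀ φ ∈ W.space.carrier, K.amp (ε.eta W hW) * W.absorb φ =
      K.amp (flip K W.space) * (star η * leg13 K K W.space W.op * η) * K.amp (K.amp φ) := by
    intro φ hφ
    rw [← hZ, eta_eq, K.amp_comp, K.amp_comp, mul_assoc, ε.isComponent hV W hW φ hφ, ← hedef,
      Corep.absorb, K.amp_comp, mul_assoc _ _ (K.amp (K.amp φ)), mul_assoc _ _ (K.amp (K.amp φ)),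
      mul_assoc _ e, he.mul_amp_amp]
    simp only [mul_assoc]
  refine K.amp_injective (W.absorb_ext fun φ hφ => ?_)
  have h1 : K.amp (K.amp φ) * K.amp V.op = K.amp l * K.amp (K.amp φ) := by
    rw [← K.amp_comp, ← K.amp_comp, leg13_mul_amp V.isArrow hφ]
  set Z := star η * leg13 K K W.space W.op * η
  calc K.amp (ε.eta W hW * W.space.amp V.op) * W.absorb φ
      = K.amp (ε.eta W hW) * W.absorb φ * K.amp V.op := by
        rw [K.amp_comp, mul_assoc, W.amp_amp_mul_absorb hφ, ← mul_assoc]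
    _ = K.amp (flip K W.space) * (Z * K.amp l) * K.amp (K.amp φ) := by
        rw [heta φ hφ, mul_assoc, h1]; simp only [mul_assoc]
    _ = K.amp (flip K W.space * l) * Z * K.amp (K.amp φ) := by
        rw [hZl, K.amp_comp]; simp only [mul_assoc]
    _ = K.amp (W.space.amp V.op * ε.eta W hW) * W.absorb φ := by
        rw [hfl, K.amp_comp, K.amp_comp, mul_assoc _ _ (W.absorb φ), heta φ hφ]
        simp only [mul_assoc]

theorem isStandard_of_eta_commute (ε : BraidedSymmetry T) (hV : Corep.regular V ∈ T.obj)
    (h : ε.eta _ hV * K.amp V.op = K.amp V.op * ε.eta _ hV) : ε.IsStandard where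
  left_regular := isLeftRegularObject_xi T
  right_regular :=
    { isIntertwiner := ε.isIntertwiner_eta
      unitary_app := ε.eta_unitary
      naturality := fun _ hW _ hW' _ hS => ε.eta_naturality hW hW' hS
      app_tensor := fun W hW W' hW' => ε.eta_tensor hW hW' (ε.eta_commute hV h W hW W') }
  commutation := fun W hW W' _ => by
    rw [xi, amp_star]
    exact mul_star_comm_of_mul_comm (W.space.amp_unitary W'.unitary_op)
      (ε.eta_commute hV h W hW W')

/-- The commutation axiom at the pair $(V,V)$, with $\xi_V=V^*$ replaced by its adjoint. -/
theorem IsStandard.eta_regular_commute {ε : BraidedSymmetry T} (h : ε.IsStandard)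
    (hV : Corep.regular V ∈ T.obj) : ε.eta _ hV * K.amp V.op = K.amp V.op * ε.eta _ hV := by
  have h1 : ε.eta _ hV * K.amp (star V.op) = K.amp (star V.op) * ε.eta _ hV :=
    h.commutation _ hV _ hV
  rw [amp_star] at h1
  simpa using mul_star_comm_of_mul_comm (Unitary.star_mem (K.amp_unitary V.unitary_op)) h1

end BraidedSymmetry

end

theorem theorem2p10 {L : Type*} [NormedAddCommGroup L] [InnerProductSpace ℂ L] [CompleteSpace L]
    (M : VonNeumannAlgebra L) (K : HilbertIn M) (V : MultiplicativeUnitary K)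
    (hirr : MultiplicativeUnitary.ActsIrreducibly K (V.generatedAlgebra : Set (L →L[ℂ] L)))
    (ε₀ : BraidedSymmetry (generatedSubcategory V)) :
    (∃! ε : BraidedSymmetry (fullCategory V), ε.Extends ε₀) ∧
      ∀ ε : BraidedSymmetry (fullCategory V), ε.Extends ε₀ → ε₀.IsStandard → ε.IsStandard := by
  have hV : Corep.regular V ∈ (generatedSubcategory V).obj := InGenerated.regular
  have hV' : Corep.regular V ∈ (fullCategory V).obj := trivial
  refine ⟨?_, fun ε hε hst => ε.isStandard_of_eta_commute hV' ?_⟩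
  · obtain ⟨ε, hε⟩ := BraidedSymmetry.exists_app_regular_eq (ε₀.isRegularBraiding hV) hirr
    -- On $\mathcal C(V)_V$ both components solve the same identity for the same $e$.
    have hext : ε.Extends ε₀ := fun W hW => (hε W).unique (ε₀.isComponent hV W hW)
    exact ⟨ε, hext, fun ε' hε' => BraidedSymmetry.ext_of_app_regular hV'
      ((hε' _ hV).trans (hext _ hV).symm)⟩
  · have h : ε.eta (Corep.regular V) hV' = ε₀.eta _ hV := by
      rw [BraidedSymmetry.eta_eq, BraidedSymmetry.eta_eq, hε _ hV]
    rw [h]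
    exact hst.eta_regular_commute hV
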